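/- Let $\mathbb{F}$ be a field of characteristic $0$. An operator monomial of degree $p$ and multiplicity $q$ is an associative word in $p$ occurrences of an argument symbol $*$, into which $q$ occurrences of a unary operator symbol $L$ (each applied to a nonempty subword) are inserted. For $a=(a_1,\dots,a_{10})$ let $$R_a=a_1L^3(**)+a_2L^2(L(*)*)+a_3L(L^2(*)*)+a_4L^3(*)*+a_5L^2(*L(*))+a_6L(L(*)L(*))+a_7L^2(*)L(*)+a_8L(*L^2(*))+a_9L(*)L^2(*)+a_{10}*L^3(*)$$ be the general operator polynomial of degree $2$ and multiplicity $3$. A consequence of $R_a$ is obtained from it by applying, in either order, one operation that raises the degree by one (replace the $i$-th argument symbol of every monomial by $**$, or multiply by $*$ on the right, or multiply by $*$ on the left) and one that raises the multiplicity by one (replace the $i$-th argument symbol of every monomial by $L(*)$, or apply $L$ to the whole expression). With $a_1,\dots,a_{10}$ indeterminate, there are $20$ distinct consequences; they are linear combinations of the $105$ operator monomials of degree $3$ and multiplicity $4$. Let $M$ be the $105\times 20$ matrix whose columns are their coefficient vectors, and for $a\in\mathbb{F}^{10}$ let $M_a$ be the matrix over $\mathbb{F}$ obtained by substituting the values $a$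 for the indeterminates. Let $a\in\mathbb{F}^{10}$ be nonzero, normalized so that its first nonzero entry is $1$. (1) $M_a$ has rank $16$ if and only if the identity $R_a=0$ is one of the following six: $$L^3(xy)=0,\quad L^3(xy)=xL^3(y),\quad L^3(xy)=L^3(x)y,\quad L^3(xy)=L^3(x)y+xL^3(y),\quad L^3(x)y=0,\quad xL^3(y)=0.$$ (2) $M_a$ has rank $19$ if and only if the identity $R_a=0$ is one of $$L^3(xy)+t\,L^2(xL(y))+t^2\,L(xL^2(y))+t^3\,xL^3(y)=0,\qquad L^3(xy)+t\,L^2(L(x)y)+t^2\,L(L^2(x)y)+t^3\,L^3(x)y=0,$$ where $t\in\{1,-1,i,-i\}\cap\mathbb{F}$ and $i^2=-1$. These are eight identities if $-1$ is a square in $\mathbb{F}$ (and only the four with $t=\pm1$ otherwise). (3) For every other normalized coefficient vector $a$, $M_a$ has full rank $20$. -/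

import Mathlib

/-- Operator monomials: nonempty associative words whose letters are the argument symbol `∗` and
`L(m)` for an operator monomial `m`.  Every monomial has exactly one such normal form:
`arg` is `∗`, `op m` is `L(m)`, `argMul m` is `∗ m`, and `opMul m n` is `L(m) n`. -/
inductive OpMon : Type
  | arg : OpMon
  | op : OpMon → OpMon
  | argMul : OpMon → OpMon
  | opMul : OpMon → OpMon → OpMon
  deriving DecidableEq

namespace OpMon

/-- The associative product of monomials (concatenation of words). -/
def mul : OpMon → OpMon → OpMon
  | arg, n => argMul n
  | op m, n => opMul m n
  | argMul m, n => argMul (mul m n)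
  | opMul m m', n => opMul m (mul m' n)

instance : Mul OpMon := ⟨mul⟩

/-- The degree: the number of argument symbols. -/
def degree : OpMon → ℕ
  | arg => 1
  | op m => m.degree
  | argMul m => m.degree + 1
  | opMul m n => m.degree + n.degree

/-- The multiplicity: the number of occurrences of the operator `L`. -/
def multiplicity : OpMon → ℕ
  | arg => 0
  | op m => m.multiplicity + 1
  | argMul m => m.multiplicity
  | opMul m n => m.multiplicity + 1 + n.multiplicity

/-- `substAt i w m` replaces the `i`-th argument symbol of `m` (counted from the left, starting
with `0`) by the monomial `w`. -/
def substAt : ℕ → OpMon → OpMon → OpMon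
  | i, w, arg => if i = 0 then w else arg
  | i, w, op m => op (substAt i w m)
  | i, w, argMul m => if i = 0 then w * m else argMul (substAt (i - 1) w m)
  | i, w, opMul m n =>
      if i < m.degree then opMul (substAt i w m) n else opMul m (substAt (i - m.degree) w n)

end OpMon

/-- The set of operator monomials of degree `p` and multiplicity `q`. -/
def operatorMonomials (p q : ℕ) : Set OpMon :=
  {m | m.degree = p ∧ m.multiplicity = q}

/-- The partial compositions with the product `B` that are available on monomials of degree `p`:
`m ∘ᵢ B` replaces the `i`-th argument by `∗∗`, `B ∘₁ m = m ∗`, and `B ∘₂ m = ∗ m`. -/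
def degreeSteps (p : ℕ) : Set (OpMon → OpMon) :=
  (fun i => OpMon.substAt i (OpMon.arg * OpMon.arg)) '' Set.Iio p ∪
    {fun m => m * OpMon.arg, fun m => OpMon.arg * m}

/-- The partial compositions with the operator `L` that are available on monomials of degree `p`:
`m ∘ᵢ L` replaces the `i`-th argument by `L(∗)`, and `L ∘ m = L(m)`. -/
def multiplicitySteps (p : ℕ) : Set (OpMon → OpMon) :=
  (fun i => OpMon.substAt i (OpMon.op OpMon.arg)) '' Set.Iio p ∪ {OpMon.op}

/-- Operator polynomials with coefficients in `S`. -/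
abbrev OpPoly (S : Type*) [CommRing S] := OpMon →₀ S

/-- The consequences of an operator polynomial `R` of degree `p`: apply (the linear extensions of)
two partial compositions, one raising the degree and one raising the multiplicity, in either
order. -/
noncomputable def consequences {S : Type*} [CommRing S] (p : ℕ) (R : OpPoly S) : Set (OpPoly S) :=
  Set.image2 (fun f g => (R.mapDomain f).mapDomain g) (degreeSteps p) (multiplicitySteps (p + 1)) ∪
    Set.image2 (fun g f => (R.mapDomain g).mapDomain f) (multiplicitySteps p) (degreeSteps p)

theorem consequences_finite {S : Type*} [CommRing S] (p : ℕ) (R : OpPoly S) :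
    (consequences p R).Finite := by
  have hd (k : ℕ) : (degreeSteps k).Finite :=
    ((Set.finite_Iio k).image _).union ((Set.finite_singleton _).insert _)
  have hm (k : ℕ) : (multiplicitySteps k).Finite :=
    ((Set.finite_Iio k).image _).union (Set.finite_singleton _)
  exact ((hd p).image2 _ (hm (p + 1))).union ((hm p).image2 _ (hd p))

noncomputable instance {S : Type*} [CommRing S] (p : ℕ) (R : OpPoly S) :
    Fintype (consequences p R) :=
  (consequences_finite p R).fintype

section Monomials
open OpMon

/-- The ten operator monomials of degree 2 and multiplicity 3, in lexicographic order:
`L³(∗∗)`, `L²(L(∗)∗)`, `L(L²(∗)∗)`, `L³(∗)∗`, `L²(∗L(∗))`,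
`L(L(∗)L(∗))`, `L²(∗)L(∗)`, `L(∗L²(∗))`, `L(∗)L²(∗)`, `∗L³(∗)`. -/
def monomials23 : Fin 10 → OpMon :=
  ![op (op (op (arg * arg))),
    op (op (op arg * arg)),
    op (op (op arg) * arg),
    op (op (op arg)) * arg,
    op (op (arg * op arg)),
    op (op arg * op arg),
    op (op arg) * op arg,
    op (arg * op (op arg)),
    op arg * op (op arg),
    arg * op (op (op arg))]

end Monomials

/-- The operator polynomial of degree 2 and multiplicity 3 with coefficients `a`. -/
noncomputable def identity23 {S : Type*} [CommRing S] (a : Fin 10 → S) : OpPoly S :=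
  ∑ k, Finsupp.single (monomials23 k) (a k)

/-- The general operator polynomial of degree 2 and multiplicity 3, with indeterminate
coefficients. -/
noncomputable def genericIdentity23 (F : Type*) [Field F] : OpPoly (MvPolynomial (Fin 10) F) :=
  identity23 MvPolynomial.X

/-- The matrix of consequences of the general operator polynomial.  The rows are indexed by the
operator monomials of degree 3 and multiplicity 4, the columns by the distinct consequences,
and the columns are the coefficient vectors of these consequences. -/
noncomputable def genericConsequenceMatrix (F : Type*) [Field F] :
    Matrix (operatorMonomials 3 4) (consequences 2 (genericIdentity23 F))
      (MvPolynomial (Fin 10) F) :=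
  Matrix.of fun m C => C.1 m.1

/-- The matrix of consequences with the values `a` substituted for the indeterminates. -/
noncomputable def consequenceMatrix {F : Type*} [Field F] (a : Fin 10 → F) :
    Matrix (operatorMonomials 3 4) (consequences 2 (genericIdentity23 F)) F :=
  (genericConsequenceMatrix F).map (MvPolynomial.eval a)

/-- The first nonzero coefficient is `1`. -/
def IsNormalized {F : Type*} [Field F] (a : Fin 10 → F) : Prop :=
  ∃ k, a k = 1 ∧ ∀ j < k, a j = 0

section Identities
open OpMon

/-- A monomial, regarded as an operator polynomial with coefficient `1`. -/
noncomputable def mono (F : Type*) [Field F] (m : OpMon) : OpPoly F := Finsupp.single m 1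

/-- The left-hand sides of the six identities `L³(xy) = 0`, `L³(xy) = x L³(y)`,
`L³(xy) = L³(x) y`, `L³(xy) = L³(x) y + x L³(y)`, `L³(x) y = 0`, `x L³(y) = 0`, with all terms
moved to the left. -/
noncomputable def rank16Identities (F : Type*) [Field F] : Set (OpPoly F) :=
  let L3xy := mono F (op (op (op (arg * arg))))
  let L3x_y := mono F (op (op (op arg)) * arg)
  let x_L3y := mono F (arg * op (op (op arg)))
  {L3xy, L3xy - x_L3y, L3xy - L3x_y, L3xy - (L3x_y + x_L3y), L3x_y, x_L3y}

/-- The four-term polynomial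
`L³(xy) + c₁ L²(x L(y)) + c₂ L(x L²(y)) + c₃ x L³(y)`. -/
noncomputable def fourTermRight {F : Type*} [Field F] (c₁ c₂ c₃ : F) : OpPoly F :=
  mono F (op (op (op (arg * arg)))) + c₁ • mono F (op (op (arg * op arg))) +
    c₂ • mono F (op (arg * op (op arg))) + c₃ • mono F (arg * op (op (op arg)))

/-- The four-term polynomial
`L³(xy) + c₁ L²(L(x) y) + c₂ L(L²(x) y) + c₃ L³(x) y`. -/
noncomputable def fourTermLeft {F : Type*} [Field F] (c₁ c₂ c₃ : F) : OpPoly F :=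
  mono F (op (op (op (arg * arg)))) + c₁ • mono F (op (op (op arg * arg))) +
    c₂ • mono F (op (op (op arg) * arg)) + c₃ • mono F (op (op (op arg)) * arg)

/-- The four-term identities with coefficients `±1`, and those with coefficients `±1, ±i` for
the square roots `i` of `-1` that lie in the field: eight identities when `-1` is a square. -/
noncomputable def rank19Identities (F : Type*) [Field F] : Set (OpPoly F) :=
  {fourTermRight 1 1 1, fourTermRight (-1) 1 (-1), fourTermLeft 1 1 1, fourTermLeft (-1) 1 (-1)} ∪
    {P | ∃ i : F, i ^ 2 = -1 ∧
      (P = fourTermRight i (-1) (-i) ∨ P = fourTermRight (-i) (-1) i ∨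
        P = fourTermLeft i (-1) (-i) ∨ P = fourTermLeft (-i) (-1) i)}

end Identities

/-!
An occurrence of `L` in a monomial covers an interval of argument symbols, and a monomial of known
degree is determined by the multiset of these intervals.  Linear combinations of monomials of a
fixed degree thus become commutative polynomials with one variable for each interval: `R_a` becomes
a general ternary cubic form, and each of the twenty consequences becomes a variable times a copy of
this cubic form in other variables.  A linear relation among the consequences is then an identity
between four products of a linear form and a cubic form, in six variables.  Comparing coefficients
shows for which `a` there are nontrivial relations, and how many; the rank is `20`
minus their dimension.
-/

namespace OpMon

theorem one_le_degree : ∀ m : OpMon, 1 ≤ m.degree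
  | arg => le_rfl
  | op m => one_le_degree m
  | argMul m => Nat.le_add_left 1 m.degree
  | opMul m _ => (one_le_degree m).trans (Nat.le_add_right _ _)

@[simp]
theorem degree_mul : ∀ m n : OpMon, (m * n).degree = m.degree + n.degree
  | arg, n => Nat.add_comm n.degree 1
  | op _, _ => rfl
  | argMul m, n => by
      change (m * n).degree + 1 = m.degree + 1 + n.degree
      rw [degree_mul m n]
      lia
  | opMul m m', n => by
      change m.degree + (m' * n).degree = m.degree + m'.degree + n.degree
      rw [degree_mul m' n, Nat.add_assoc]

theorem degree_substAt {w : OpMon} {d : ℕ} (hw : w.degree = d + 1) :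
    ∀ {m : OpMon} {j : ℕ}, j < m.degree → (substAt j w m).degree = m.degree + d
  | arg, j, hj => by
      obtain rfl : j = 0 := by simpa [degree] using hj
      simp only [substAt, if_true, hw, degree, Nat.add_comm]
  | op m, _, hj => degree_substAt (m := m) hw hj
  | argMul m, 0, _ => by
      simp only [substAt, if_true, degree_mul, hw, degree]
      lia
  | argMul m, j + 1, hj => by
      have hm : (substAt j w m).degree = m.degree + d :=
        degree_substAt hw (Nat.lt_of_add_lt_add_right hj)
      simp only [substAt, Nat.add_one_ne_zero, if_false, Nat.add_sub_cancel, degree, hm]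
      lia
  | opMul m n, j, hj => by
      by_cases hjm : j < m.degree
      · simp only [substAt, if_pos hjm, degree, degree_substAt hw hjm]
        lia
      · have hn : (substAt (j - m.degree) w n).degree = n.degree + d :=
          degree_substAt hw (by simp only [degree] at hj; lia)
        simp only [substAt, if_neg hjm, degree, hn]
        lia

/-- Translation by `k` of intervals of argument positions, given by their end points. -/
def shift (k : ℕ) : ℕ × ℕ → ℕ × ℕ := Prod.map (· + k) (· + k)

theorem shift_injective (k : ℕ) : Function.Injective (shift k) :=
  (add_left_injective k).prodMap (add_left_injective k)

/-- The multiset of intervals `[x, y)` of argument positions (counted from `0`) covered by the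
occurrences of `L` in a monomial.  A monomial is encoded by its degree and this multiset, and
partial compositions act on the latter by moving end points and adjoining intervals. -/
def intervals : OpMon → Multiset (ℕ × ℕ)
  | arg => 0
  | op m => (0, m.degree) ::ₘ m.intervals
  | argMul m => m.intervals.map (shift 1)
  | opMul m n => (0, m.degree) ::ₘ (m.intervals + n.intervals.map (shift m.degree))

theorem lt_and_le_degree_of_mem_intervals :
    ∀ {m : OpMon} {x y : ℕ}, (x, y) ∈ m.intervals → x < y ∧ y ≤ m.degree
  | arg, _, _, h => absurd h (Multiset.notMem_zero _)
  | op m, x, y, h => by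
      rcases Multiset.mem_cons.1 h with h | h
      · obtain ⟨rfl, rfl⟩ := Prod.mk.inj h
        exact ⟨one_le_degree m, le_rfl⟩
      · exact lt_and_le_degree_of_mem_intervals (m := m) h
  | argMul m, x, y, h => by
      obtain ⟨⟨x', y'⟩, h', hxy⟩ := Multiset.mem_map.1 h
      obtain ⟨rfl, rfl⟩ := Prod.mk.inj hxy
      have := lt_and_le_degree_of_mem_intervals h'
      simp only [degree]
      lia
  | opMul m n, x, y, h => by
      rcases Multiset.mem_cons.1 h with h | h
      · obtain ⟨rfl, rfl⟩ := Prod.mk.inj h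
        exact ⟨one_le_degree m, Nat.le_add_right _ _⟩
      rcases Multiset.mem_add.1 h with h | h
      · have := lt_and_le_degree_of_mem_intervals h
        simp only [degree]
        lia
      · obtain ⟨⟨x', y'⟩, h', hxy⟩ := Multiset.mem_map.1 h
        obtain ⟨rfl, rfl⟩ := Prod.mk.inj hxy
        have := lt_and_le_degree_of_mem_intervals h'
        simp only [degree]
        lia

theorem le_fst_of_mem_map_shift {k x y : ℕ} {s : Multiset (ℕ × ℕ)}
    (h : (x, y) ∈ s.map (shift k)) : k ≤ x := by
  obtain ⟨_, _, h'⟩ := Multiset.mem_map.1 h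
  exact (Nat.le_add_left k _).trans_eq (congrArg Prod.fst h')

theorem le_degree_of_zero_mem_intervals_opMul {m n : OpMon} {k : ℕ}
    (h : (0, k) ∈ (opMul m n).intervals) : k ≤ m.degree := by
  rcases Multiset.mem_cons.1 h with h | h
  · exact (congrArg Prod.snd h).le
  rcases Multiset.mem_add.1 h with h | h
  · exact (lt_and_le_degree_of_mem_intervals h).2
  · exact absurd (le_fst_of_mem_map_shift h) (by have := one_le_degree m; lia)

theorem filter_intervals_add_map_shift (m n : OpMon) :
    (m.intervals + n.intervals.map (shift m.degree)).filter (·.2 ≤ m.degree) = m.intervals := by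
  rw [Multiset.filter_add, Multiset.filter_eq_self.2, Multiset.filter_eq_nil.2, add_zero]
  · rintro ⟨x, y⟩ h hy
    have hx := le_fst_of_mem_map_shift h
    obtain ⟨⟨x', y'⟩, h', hxy⟩ := Multiset.mem_map.1 h
    obtain ⟨rfl, rfl⟩ := Prod.mk.inj hxy
    have := lt_and_le_degree_of_mem_intervals h'
    simp only at hy
    lia
  · exact fun P h => (lt_and_le_degree_of_mem_intervals h).2

theorem mem_intervals_op (m : OpMon) : (0, m.degree) ∈ (op m).intervals :=
  Multiset.mem_cons_self _ _

theorem mem_intervals_opMul (m n : OpMon) : (0, m.degree) ∈ (opMul m n).intervals :=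
  Multiset.mem_cons_self _ _

theorem zero_notMem_intervals_argMul {k : ℕ} (m : OpMon) : (0, k) ∉ (argMul m).intervals :=
  fun h => Nat.not_succ_le_zero 0 (le_fst_of_mem_map_shift h)

theorem intervals_op_ne_intervals_opMul {m n n' : OpMon}
    (hd : (op m).degree = (opMul n n').degree) :
    (op m).intervals ≠ (opMul n n').intervals := fun h => by
  have hm : m.degree ≤ n.degree :=
    le_degree_of_zero_mem_intervals_opMul (h ▸ mem_intervals_op m)
  have := one_le_degree n'
  simp only [degree] at hd
  lia

theorem eq_of_intervals_eq :
    ∀ {m n : OpMon}, m.degree = n.degree → m.intervals = n.intervals → m = n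
  | arg, arg, _, _ => rfl
  | arg, op _, _, h => absurd h Multiset.zero_ne_cons
  | arg, argMul n, hd, _ => absurd hd (by have := one_le_degree n; simp only [degree]; lia)
  | arg, opMul _ _, _, h => absurd h Multiset.zero_ne_cons
  | op _, arg, _, h => absurd h Multiset.cons_ne_zero
  | op m, op n, hd, h => by
      have hd : m.degree = n.degree := hd
      simp only [intervals, hd, Multiset.cons_inj_right] at h
      rw [eq_of_intervals_eq hd h]
  | op m, argMul n, _, h => absurd (h ▸ mem_intervals_op m) (zero_notMem_intervals_argMul n)
  | op _, opMul _ _, hd, h => absurd h (intervals_op_ne_intervals_opMul hd)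
  | argMul m, arg, hd, _ => absurd hd (by have := one_le_degree m; simp only [degree]; lia)
  | argMul m, op n, _, h => absurd (h ▸ mem_intervals_op n) (zero_notMem_intervals_argMul m)
  | argMul _, argMul _, hd, h => by
      rw [eq_of_intervals_eq (Nat.add_right_cancel hd)
        (Multiset.map_injective (shift_injective 1) h)]
  | argMul m, opMul n n', _, h =>
      absurd (h ▸ mem_intervals_opMul n n') (zero_notMem_intervals_argMul m)
  | opMul _ _, arg, _, h => absurd h Multiset.cons_ne_zero
  | opMul _ _, op _, hd, h => absurd h.symm (intervals_op_ne_intervals_opMul hd.symm)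
  | opMul m m', argMul n, _, h =>
      absurd (h ▸ mem_intervals_opMul m m') (zero_notMem_intervals_argMul n)
  | opMul m m', opMul n n', hd, h => by
      have hmn : m.degree = n.degree := le_antisymm
        (le_degree_of_zero_mem_intervals_opMul (h ▸ mem_intervals_opMul m m'))
        (le_degree_of_zero_mem_intervals_opMul (h ▸ mem_intervals_opMul n n'))
      simp only [intervals, hmn, Multiset.cons_inj_right] at h
      have hm : m.intervals = n.intervals := by
        rw [← filter_intervals_add_map_shift m m', ← filter_intervals_add_map_shift n n', hmn, h]
      rw [hm, add_right_inj] at h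
      simp only [degree, hmn, add_right_inj] at hd
      rw [eq_of_intervals_eq hmn hm,
        eq_of_intervals_eq hd (Multiset.map_injective (shift_injective n.degree) h)]

theorem shift_comp_shift (k l : ℕ) : shift l ∘ shift k = shift (k + l) := by
  ext P <;> simp [shift, Nat.add_assoc]

theorem intervals_mul :
    ∀ m n : OpMon, (m * n).intervals = m.intervals + n.intervals.map (shift m.degree)
  | arg, n => (zero_add (n.intervals.map (shift 1))).symm
  | op _, _ => (Multiset.cons_add _ _ _).symm
  | argMul m, n => by
      change (m * n).intervals.map (shift 1) = _
      rw [intervals_mul m n, Multiset.map_add, Multiset.map_map, shift_comp_shift]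
      rfl
  | opMul m m', n => by
      change (0, m.degree) ::ₘ (m.intervals + (m' * n).intervals.map (shift m.degree)) = _
      rw [intervals_mul m' n, Multiset.map_add, Multiset.map_map, shift_comp_shift,
        Nat.add_comm m'.degree, ← add_assoc, ← Multiset.cons_add]
      rfl

/-- The effect on an interval of replacing the argument at position `j` by a word of degree
`d + 1`: the end points to the right of that position move by `d`. -/
def stretch (j d : ℕ) : ℕ × ℕ → ℕ × ℕ :=
  Prod.map (fun x => if x ≤ j then x else x + d) (fun x => if x ≤ j then x else x + d)

theorem stretch_comp_shift (j k d : ℕ) :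
    stretch (j + k) d ∘ shift k = shift k ∘ stretch j d := by
  ext P <;> simp only [stretch, shift, Function.comp_apply, Prod.map_fst, Prod.map_snd,
    Nat.add_le_add_iff_right] <;> split_ifs <;> lia

theorem map_stretch_map_shift (j k d : ℕ) (s : Multiset (ℕ × ℕ)) :
    (s.map (shift k)).map (stretch (j + k) d) = (s.map (stretch j d)).map (shift k) := by
  rw [Multiset.map_map, stretch_comp_shift, ← Multiset.map_map]

theorem map_stretch_map_shift_intervals {j k : ℕ} (hjk : j < k) (d : ℕ) (m : OpMon) :
    (m.intervals.map (shift k)).map (stretch j d) = m.intervals.map (shift (k + d)) := by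
  rw [Multiset.map_map]
  refine Multiset.map_congr rfl fun P hP => ?_
  have := lt_and_le_degree_of_mem_intervals hP
  ext <;> simp only [stretch, shift, Function.comp_apply, Prod.map_fst, Prod.map_snd] <;>
    split_ifs <;> lia

theorem map_stretch_intervals_of_degree_le {m : OpMon} {j : ℕ} (hj : m.degree ≤ j) (d : ℕ) :
    m.intervals.map (stretch j d) = m.intervals := by
  conv_rhs => rw [← Multiset.map_id m.intervals]
  refine Multiset.map_congr rfl fun P hP => ?_
  have := lt_and_le_degree_of_mem_intervals hP
  ext <;> simp only [stretch, id_eq, Prod.map_fst, Prod.map_snd] <;> split_ifs <;> lia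

theorem stretch_zero_of_lt {j k : ℕ} (hjk : j < k) (d : ℕ) : stretch j d (0, k) = (0, k + d) := by
  simp [stretch, hjk]

theorem stretch_zero_of_le {j k : ℕ} (hkj : k ≤ j) (d : ℕ) : stretch j d (0, k) = (0, k) := by
  simp [stretch, hkj]

theorem intervals_substAt {w : OpMon} {d : ℕ} (hw : w.degree = d + 1) :
    ∀ {m : OpMon} {j : ℕ}, j < m.degree →
      (substAt j w m).intervals = m.intervals.map (stretch j d) + w.intervals.map (shift j)
  | arg, j, hj => by
      obtain rfl : j = 0 := by simpa [degree] using hj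
      have : shift 0 = id := rfl
      simp only [substAt, if_true, intervals, Multiset.map_zero, zero_add, this, Multiset.map_id]
  | op m, j, hj => by
      simp only [degree] at hj
      simp only [substAt, intervals, intervals_substAt hw hj, degree_substAt hw hj,
        Multiset.map_cons, stretch_zero_of_lt hj, Multiset.cons_add]
  | argMul m, 0, _ => by
      have : shift 0 = id := rfl
      simp only [substAt, if_true, intervals_mul, hw, intervals, this, Multiset.map_id,
        map_stretch_map_shift_intervals Nat.zero_lt_one]
      rw [add_comm, Nat.add_comm d 1]
  | argMul m, j + 1, hj => by
      have ih : (substAt j w m).intervals = _ :=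
        intervals_substAt hw (Nat.lt_of_add_lt_add_right hj)
      simp only [substAt, Nat.add_one_ne_zero, if_false, Nat.add_sub_cancel, intervals, ih,
        Multiset.map_add, map_stretch_map_shift]
      rw [Multiset.map_map _ _ w.intervals, shift_comp_shift]
  | opMul m n, j, hj => by
      by_cases hjm : j < m.degree
      · simp only [substAt, if_pos hjm, intervals, intervals_substAt hw hjm,
          degree_substAt hw hjm, Multiset.map_cons, Multiset.map_add, stretch_zero_of_lt hjm,
          Multiset.cons_add, map_stretch_map_shift_intervals hjm]
        rw [add_right_comm]
      · obtain ⟨i, rfl⟩ := Nat.exists_eq_add_of_le' (Nat.le_of_not_lt hjm)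
        have hi : i < n.degree := by
          simp only [degree] at hj
          lia
        have hm : m.degree ≤ i + m.degree := Nat.le_add_left _ _
        simp only [substAt, if_neg hjm, intervals, Nat.add_sub_cancel, intervals_substAt hw hi,
          Multiset.map_cons, Multiset.map_add, stretch_zero_of_le hm, map_stretch_map_shift,
          map_stretch_intervals_of_degree_le hm, Multiset.cons_add]
        rw [Multiset.map_map _ _ w.intervals, shift_comp_shift, add_assoc]

end OpMon

section Symbol

open MvPolynomial OpMon

variable (S : Type*) [CommRing S]

/-- The commutative monomial that encodes an operator monomial: the product of one variable for
each interval of argument positions covered by an occurrence of `L`. -/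
noncomputable def symbol (m : OpMon) : MvPolynomial (ℕ × ℕ) S :=
  (m.intervals.map X).prod

theorem prod_map_X_eq_monomial (s : Multiset (ℕ × ℕ)) :
    (s.map X).prod = monomial (Multiset.toFinsupp s) (1 : S) := by
  induction s using Multiset.induction_on with
  | empty => simp
  | cons P s ih =>
    rw [Multiset.map_cons, Multiset.prod_cons, ih, ← Multiset.singleton_add, map_add,
      Multiset.toFinsupp_singleton, X, monomial_mul, one_mul]

theorem rename_prod_map_X (f : ℕ × ℕ → ℕ × ℕ) (s : Multiset (ℕ × ℕ)) :
    rename f (s.map X).prod = ((s.map f).map (X : _ → MvPolynomial (ℕ × ℕ) S)).prod := by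
  simp only [map_multiset_prod, Multiset.map_map, Function.comp_def, rename_X]

@[simp]
theorem symbol_arg : symbol S arg = 1 := Multiset.prod_zero

@[simp]
theorem symbol_op (m : OpMon) : symbol S (op m) = X (0, m.degree) * symbol S m := by
  simp only [symbol, intervals, Multiset.map_cons, Multiset.prod_cons]

@[simp]
theorem symbol_mul (m n : OpMon) :
    symbol S (m * n) = symbol S m * rename (shift m.degree) (symbol S n) := by
  simp only [symbol, intervals_mul, Multiset.map_add, Multiset.prod_add, rename_prod_map_X]

variable {S} in
theorem symbol_substAt {w m : OpMon} {d j : ℕ} (hw : w.degree = d + 1) (hj : j < m.degree) :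
    symbol S (substAt j w m) =
      rename (stretch j d) (symbol S m) * rename (shift j) (symbol S w) := by
  simp only [symbol, intervals_substAt hw hj, Multiset.map_add, Multiset.prod_add,
    rename_prod_map_X]

theorem linearIndepOn_symbol (d : ℕ) :
    LinearIndepOn S (symbol S) {m | m.degree = d} := by
  have hinj : Function.Injective fun m : {m : OpMon | m.degree = d} =>
      Multiset.toFinsupp m.1.intervals := fun m n h =>
    Subtype.ext (eq_of_intervals_eq (m.2.trans n.2.symm) (Multiset.toFinsupp.injective h))
  simpa only [LinearIndepOn, symbol, prod_map_X_eq_monomial, coe_basisMonomials,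
    Function.comp_def] using
    (basisMonomials (ℕ × ℕ) S).linearIndependent.comp _ hinj

/-- The linear extension of `symbol` to operator polynomials. -/
noncomputable def symbolMap : OpPoly S →ₗ[S] MvPolynomial (ℕ × ℕ) S :=
  Finsupp.linearCombination S (symbol S)

variable {S} in
theorem symbolMap_eq_zero_iff {d : ℕ} {P : OpPoly S}
    (hP : P ∈ Finsupp.supported S S {m | m.degree = d}) : symbolMap S P = 0 ↔ P = 0 :=
  ⟨linearIndepOn_iff.1 (linearIndepOn_symbol S d) P hP, fun h => by rw [h, map_zero]⟩

end Symbol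

section Consequences

open OpMon

/-- The partial compositions with the product on polynomials of degree `2`. -/
def degreeStep : Fin 4 → OpMon → OpMon :=
  ![substAt 0 (arg * arg), substAt 1 (arg * arg), (· * arg), (arg * ·)]

/-- The twenty compositions of partial compositions that yield the distinct consequences of a
polynomial of degree `2`.  Only for the last index does the multiplicity rise first; the other
compositions in that order agree with compositions in the opposite order. -/
def consequenceStep (i : Fin 4) : Fin 5 → OpMon → OpMon :=
  ![substAt 0 (op arg) ∘ degreeStep i, substAt 1 (op arg) ∘ degreeStep i,
    substAt 2 (op arg) ∘ degreeStep i, op ∘ degreeStep i,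
    degreeStep i ∘ ![substAt 0 (op arg), substAt 1 (op arg), op, op] i]

/-- The consequence of the general polynomial of degree `2` and multiplicity `3` produced by
`consequenceStep`, with coefficients `a`. -/
noncomputable def consequence {S : Type*} [CommRing S] (a : Fin 10 → S) (x : Fin 4 × Fin 5) :
    OpPoly S :=
  (identity23 a).mapDomain (consequenceStep x.1 x.2)

/-- The effect of `degreeStep` on the intervals covered by the occurrences of `L`. -/
def intervalMap : Fin 4 → ℕ × ℕ → ℕ × ℕ :=
  ![stretch 0 1, stretch 1 1, id, shift 1]

/-- The interval covered by the occurrence of `L` that `consequenceStep` inserts. -/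
def newInterval (i : Fin 4) : Fin 5 → ℕ × ℕ :=
  ![(0, 1), (1, 2), (2, 3), (0, 3), ![(0, 2), (1, 3), (0, 2), (1, 3)] i]

theorem degree_degreeStep {m : OpMon} (hm : m.degree = 2) (i : Fin 4) :
    (degreeStep i m).degree = 3 := by
  fin_cases i
  · exact (degree_substAt (d := 1) rfl (by lia)).trans (congrArg (· + 1) hm)
  · exact (degree_substAt (d := 1) rfl (by lia)).trans (congrArg (· + 1) hm)
  · exact (degree_mul m arg).trans (congrArg (· + 1) hm)
  · exact (degree_mul arg m).trans (congrArg (1 + ·) hm)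

theorem symbol_degreeStep (S : Type*) [CommRing S] {m : OpMon} (hm : m.degree = 2) (i : Fin 4) :
    symbol S (degreeStep i m) = MvPolynomial.rename (intervalMap i) (symbol S m) := by
  fin_cases i
  · exact (symbol_substAt (d := 1) rfl (by lia)).trans (by simp [intervalMap])
  · exact (symbol_substAt (d := 1) rfl (by lia)).trans (by simp [intervalMap])
  · exact (symbol_mul S m arg).trans (by simp [intervalMap])
  · exact (symbol_mul S arg m).trans (by simp [intervalMap, degree])

theorem symbol_substAt_op_arg (S : Type*) [CommRing S] {m : OpMon} {j : ℕ} (hj : j < m.degree) :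
    symbol S (substAt j (op arg) m) = MvPolynomial.X (j, j + 1) * symbol S m := by
  have hid : stretch j 0 = id := by ext <;> simp [stretch]
  rw [symbol_substAt (d := 0) rfl hj, hid, MvPolynomial.rename_id_apply, mul_comm]
  simp [shift, degree, Nat.add_comm]

theorem symbol_consequenceStep (S : Type*) [CommRing S] {m : OpMon} (hm : m.degree = 2)
    (i : Fin 4) (v : Fin 5) :
    symbol S (consequenceStep i v m) = MvPolynomial.X (newInterval i v) *
      MvPolynomial.rename (intervalMap i) (symbol S m) := by
  have h3 := degree_degreeStep hm i
  rw [← symbol_degreeStep S hm i]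
  fin_cases v
  · exact symbol_substAt_op_arg S (by lia)
  · exact symbol_substAt_op_arg S (by lia)
  · exact symbol_substAt_op_arg S (by lia)
  · exact (symbol_op S _).trans (by rw [h3]; rfl)
  · have hinner (f : OpMon → OpMon) (P : ℕ × ℕ) (hf : (f m).degree = 2)
        (hs : symbol S (f m) = MvPolynomial.X P * symbol S m) :
        symbol S (degreeStep i (f m)) =
          MvPolynomial.X (intervalMap i P) * symbol S (degreeStep i m) := by
      rw [symbol_degreeStep S hf, hs, map_mul, MvPolynomial.rename_X, symbol_degreeStep S hm]
    fin_cases i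
    · exact hinner _ (0, 1) ((degree_substAt (d := 0) rfl (by lia)).trans hm)
        (symbol_substAt_op_arg S (by lia))
    · exact hinner _ (1, 2) ((degree_substAt (d := 0) rfl (by lia)).trans hm)
        (symbol_substAt_op_arg S (by lia))
    · exact hinner _ (0, 2) hm ((symbol_op S m).trans (by rw [hm]))
    · exact hinner _ (0, 2) hm ((symbol_op S m).trans (by rw [hm]))

theorem mapDomain_identity23 {S : Type*} [CommRing S] (a : Fin 10 → S) (f : OpMon → OpMon) :
    (identity23 a).mapDomain f = ∑ k, Finsupp.single (f (monomials23 k)) (a k) := by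
  simp only [identity23, Finsupp.mapDomain_finsetSum, Finsupp.mapDomain_single]

theorem mapDomain_identity23_congr {S : Type*} [CommRing S] (a : Fin 10 → S)
    {f g : OpMon → OpMon} (h : ∀ k, f (monomials23 k) = g (monomials23 k)) :
    (identity23 a).mapDomain f = (identity23 a).mapDomain g := by
  simp only [mapDomain_identity23, h]

theorem image_Iio_eq_range {α : Type*} (f : ℕ → α) (n : ℕ) :
    f '' Set.Iio n = Set.range fun i : Fin n => f i := by
  rw [← Fin.range_val, ← Set.range_comp]
  rfl

theorem degreeSteps_two : degreeSteps 2 = Set.range degreeStep := by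
  ext f
  simp [degreeSteps, degreeStep, image_Iio_eq_range, Fin.exists_fin_succ, or_comm, or_left_comm,
    eq_comm]

/-- The partial compositions with the operator on polynomials of degree `p`, the last one being
the application of `L` to the whole. -/
def multiplicityStep (p : ℕ) : Fin (p + 1) → OpMon → OpMon :=
  Fin.snoc (fun i : Fin p => substAt i (op arg)) op

theorem multiplicitySteps_eq_range (p : ℕ) :
    multiplicitySteps p = Set.range (multiplicityStep p) := by
  rw [multiplicitySteps, multiplicityStep, image_Iio_eq_range, Fin.range_snoc, Set.union_singleton]

theorem consequences_identity23 {S : Type*} [CommRing S] (a : Fin 10 → S) :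
    consequences 2 (identity23 a) = Set.range (consequence a) := by
  have hlast : ∀ i, ∃ j, ∀ k, degreeStep i (multiplicityStep 2 j (monomials23 k)) =
      consequenceStep i 4 (monomials23 k) := by decide +kernel
  have hinit : ∀ i j k, multiplicityStep 3 j (degreeStep i (monomials23 k)) =
      consequenceStep i j.castSucc (monomials23 k) := by decide +kernel
  have hswap : ∀ i j, ∃ v, ∀ k, degreeStep i (multiplicityStep 2 j (monomials23 k)) =
      consequenceStep i v (monomials23 k) := by decide +kernel
  simp only [consequences, degreeSteps_two, multiplicitySteps_eq_range, Set.image2_range,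
    ← Finsupp.mapDomain_comp]
  refine Set.Subset.antisymm (Set.union_subset ?_ ?_) ?_
  · rintro _ ⟨⟨i, j⟩, rfl⟩
    exact ⟨(i, j.castSucc), (mapDomain_identity23_congr a (hinit i j)).symm⟩
  · rintro _ ⟨⟨j, i⟩, rfl⟩
    obtain ⟨v, hv⟩ := hswap i j
    exact ⟨(i, v), (mapDomain_identity23_congr a hv).symm⟩
  · rintro _ ⟨⟨i, v⟩, rfl⟩
    induction v using Fin.lastCases with
    | last =>
      obtain ⟨j, hj⟩ := hlast i
      exact Or.inr ⟨(j, i), mapDomain_identity23_congr a hj⟩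
    | cast j => exact Or.inl ⟨(i, j), mapDomain_identity23_congr a (hinit i j)⟩

theorem sum_single_X_injective (S : Type*) [CommRing S] [Nontrivial S] (σ α : Type*)
    [Fintype σ] : Function.Injective fun T : σ → α =>
      ∑ k, Finsupp.single (T k) (MvPolynomial.X k : MvPolynomial σ S) := by
  classical
  intro T T' h
  funext k
  have heval (T : σ → α) : Finsupp.mapRange (MvPolynomial.eval (Pi.single k (1 : S))) (map_zero _)
      (∑ l, Finsupp.single (T l) (MvPolynomial.X l)) = Finsupp.single (T k) 1 := by
    rw [Finsupp.mapRange_finsetSum, Fintype.sum_eq_single k]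
    · simp
    · intro l hl
      simp [hl]
  exact Finsupp.single_left_injective one_ne_zero
    ((heval T).symm.trans ((congrArg _ h).trans (heval T')))

theorem consequence_X_injective (F : Type*) [Field F] :
    Function.Injective (consequence (MvPolynomial.X : Fin 10 → MvPolynomial (Fin 10) F)) := by
  have hT : Function.Injective fun (x : Fin 4 × Fin 5) k =>
      consequenceStep x.1 x.2 (monomials23 k) := by
    unfold Function.Injective
    decide +kernel
  have hc : consequence (MvPolynomial.X : Fin 10 → MvPolynomial (Fin 10) F) = fun x =>
      ∑ k, Finsupp.single (consequenceStep x.1 x.2 (monomials23 k)) (MvPolynomial.X k) :=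
    funext fun x => mapDomain_identity23 _ _
  rw [hc]
  exact (sum_single_X_injective F (Fin 10) OpMon).comp hT

/-- The numbering of the distinct consequences of the general polynomial. -/
noncomputable def consequenceEquiv (F : Type*) [Field F] :
    Fin 4 × Fin 5 ≃ consequences 2 (genericIdentity23 F) :=
  (Equiv.ofInjective _ (consequence_X_injective F)).trans
    (Equiv.setCongr (consequences_identity23 _).symm)

theorem card_consequences_genericIdentity23 (F : Type*) [Field F] :
    Nat.card (consequences 2 (genericIdentity23 F)) = 20 := by
  rw [← Nat.card_congr (consequenceEquiv F), Nat.card_eq_fintype_card]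
  rfl

theorem consequenceMatrix_apply {F : Type*} [Field F] (a : Fin 10 → F)
    (m : operatorMonomials 3 4) (x : Fin 4 × Fin 5) :
    consequenceMatrix a m (consequenceEquiv F x) = consequence a x m := by
  change MvPolynomial.eval a (consequence MvPolynomial.X x m.1) = _
  simp [consequence, mapDomain_identity23, Finsupp.finsetSum_apply, Finsupp.single_apply,
    apply_ite]

/-- The linear relations between the consequences of `identity23 a`, as coefficient vectors. -/
noncomputable def relations {F : Type*} [Field F] (a : Fin 10 → F) :
    Submodule F (Fin 4 → Fin 5 → F) :=
  LinearMap.ker (Fintype.linearCombination F (consequence a) ∘ₗ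
    (LinearEquiv.curry F F (Fin 4) (Fin 5)).symm.toLinearMap)

theorem consequence_mem_supported {F : Type*} [Field F] (a : Fin 10 → F) (x : Fin 4 × Fin 5) :
    consequence a x ∈ Finsupp.supported F F (operatorMonomials 3 4) := by
  have hmem : ∀ i v k, (consequenceStep i v (monomials23 k)).degree = 3 ∧
      (consequenceStep i v (monomials23 k)).multiplicity = 4 := by decide +kernel
  rw [consequence, mapDomain_identity23]
  exact Submodule.sum_mem _ fun k _ => Finsupp.single_mem_supported F _ (hmem x.1 x.2 k)

theorem mulVec_consequenceMatrix_eq_zero_iff {F : Type*} [Field F] (a : Fin 10 → F)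
    (c : Fin 4 × Fin 5 → F) :
    ((consequenceMatrix a).submatrix id (consequenceEquiv F)).mulVec c = 0 ↔
      Fintype.linearCombination F (consequence a) c = 0 := by
  have hsupp : Fintype.linearCombination F (consequence a) c ∈
      Finsupp.supported F F (operatorMonomials 3 4) :=
    Submodule.sum_mem _ fun x _ => Submodule.smul_mem _ _ (consequence_mem_supported a x)
  have hval (m : operatorMonomials 3 4) :
      ((consequenceMatrix a).submatrix id (consequenceEquiv F)).mulVec c m =
        Fintype.linearCombination F (consequence a) c m.1 := by
    simp [Matrix.mulVec, dotProduct, consequenceMatrix_apply, mul_comm,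
      Fintype.linearCombination_apply, Finsupp.finsetSum_apply]
  refine ⟨fun h => ?_, fun h => funext fun m => (hval m).trans (by rw [h]; rfl)⟩
  ext m
  by_cases hm : m ∈ operatorMonomials 3 4
  · exact (hval ⟨m, hm⟩).symm.trans (congrFun h _)
  · exact Finsupp.notMem_support_iff.1 fun hs => hm (hsupp hs)

theorem rank_consequenceMatrix_add_finrank_relations {F : Type*} [Field F] (a : Fin 10 → F) :
    (consequenceMatrix a).rank + Module.finrank F (relations a) = 20 := by
  let M := (consequenceMatrix a).submatrix id (consequenceEquiv F)
  have hM : M.rank = (consequenceMatrix a).rank :=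
    Matrix.rank_submatrix _ (Equiv.refl _) (consequenceEquiv F)
  have hker : LinearMap.ker (Fintype.linearCombination F (consequence a)) =
      LinearMap.ker M.mulVecLin :=
    Submodule.ext fun c => (mulVec_consequenceMatrix_eq_zero_iff a c).symm
  have hrel : Module.finrank F (relations a) = Module.finrank F (LinearMap.ker M.mulVecLin) := by
    rw [relations, LinearMap.ker_comp, hker]
    exact ((LinearEquiv.curry F F (Fin 4) (Fin 5)).symm.ofSubmodule' _).finrank_eq
  rw [← hM, hrel, Matrix.rank, LinearMap.finrank_range_add_finrank_ker, Module.finrank_pi,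
    Fintype.card_prod, Fintype.card_fin, Fintype.card_fin]

end Consequences

section RelationForm

open OpMon

/-- The general ternary cubic form, with its monomials in the order of `monomials23`. -/
def cubic {R : Type*} [CommRing R] (a : Fin 10 → R) (x y z : R) : R :=
  a 0 * x ^ 3 + a 1 * x ^ 2 * y + a 2 * x * y ^ 2 + a 3 * y ^ 3 + a 4 * x ^ 2 * z +
    a 5 * x * y * z + a 6 * y ^ 2 * z + a 7 * x * z ^ 2 + a 8 * y * z ^ 2 + a 9 * z ^ 3

/-- The linear form with coefficients `c`. -/
def linearForm {R : Type*} [CommRing R] (c : Fin 5 → R) (r s t u w : R) : R :=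
  c 0 * r + c 1 * s + c 2 * t + c 3 * u + c 4 * w

/-- The symbol of the linear combination with coefficients `c` of the consequences of a polynomial
with symbol `cubic a`.  The variables `r`, `s`, `t` stand for an occurrence of `L` that covers the
first, second, third of the three arguments, `p` and `q` for one that covers the first two and the
last two, and `u` for one that covers all three. -/
def relationForm {R : Type*} [CommRing R] (a : Fin 10 → R) (c : Fin 4 → Fin 5 → R)
    (u r s t p q : R) : R :=
  linearForm (c 0) r s t u p * cubic a u p t + linearForm (c 1) r s t u q * cubic a u r q +
    linearForm (c 2) r s t u p * cubic a p r s + linearForm (c 3) r s t u q * cubic a q s t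

theorem degree_monomials23 (k : Fin 10) : (monomials23 k).degree = 2 := by
  revert k
  decide

theorem symbolMap_identity23 {S : Type*} [CommRing S] (a : Fin 10 → S) :
    symbolMap S (identity23 a) = cubic (fun k => MvPolynomial.C (a k))
      (MvPolynomial.X (0, 2)) (MvPolynomial.X (0, 1)) (MvPolynomial.X (1, 2)) := by
  simp only [symbolMap, identity23, map_sum, Finsupp.linearCombination_single, cubic,
    MvPolynomial.smul_eq_C_mul]
  simp only [Fin.sum_univ_succ, Finset.univ_unique, Finset.sum_singleton, Fin.default_eq_zero,
    Fin.succ_zero_eq_one, Fin.succ_one_eq_two, Fin.reduceSucc, monomials23,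
    Matrix.cons_val_zero, Matrix.cons_val_succ, Matrix.cons_val_fin_one, symbol_op, symbol_mul,
    symbol_arg, degree, degree_mul, Nat.reduceAdd, shift, Prod.map_apply, zero_add,
    MvPolynomial.rename_X, map_mul, map_one, mul_one, one_mul]
  ring

theorem symbolMap_consequence {S : Type*} [CommRing S] (a : Fin 10 → S) (x : Fin 4 × Fin 5) :
    symbolMap S (consequence a x) = MvPolynomial.X (newInterval x.1 x.2) *
      MvPolynomial.rename (intervalMap x.1) (symbolMap S (identity23 a)) := by
  rw [consequence, mapDomain_identity23, identity23]
  simp only [symbolMap, map_sum, Finsupp.linearCombination_single, map_smul, Finset.mul_sum,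
    symbol_consequenceStep S (degree_monomials23 _), mul_smul_comm]

theorem symbolMap_linearCombination_consequence {F : Type*} [Field F] (a : Fin 10 → F)
    (c : Fin 4 → Fin 5 → F) :
    symbolMap F (Fintype.linearCombination F (consequence a) fun x => c x.1 x.2) =
      relationForm (fun k => MvPolynomial.C (a k)) (fun i v => MvPolynomial.C (c i v))
        (MvPolynomial.X (0, 3)) (MvPolynomial.X (0, 1)) (MvPolynomial.X (1, 2))
        (MvPolynomial.X (2, 3)) (MvPolynomial.X (0, 2)) (MvPolynomial.X (1, 3)) := by
  have hrename (i : Fin 4) : MvPolynomial.rename (intervalMap i) (symbolMap F (identity23 a)) =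
      cubic (fun k => MvPolynomial.C (a k)) (MvPolynomial.X (intervalMap i (0, 2)))
        (MvPolynomial.X (intervalMap i (0, 1))) (MvPolynomial.X (intervalMap i (1, 2))) := by
    simp only [symbolMap_identity23, cubic, map_add, map_mul, map_pow, MvPolynomial.rename_C,
      MvPolynomial.rename_X]
  have hrow (i : Fin 4) : linearForm (fun v => MvPolynomial.C (c i v)) (MvPolynomial.X (0, 1))
      (MvPolynomial.X (1, 2)) (MvPolynomial.X (2, 3)) (MvPolynomial.X (0, 3))
      (MvPolynomial.X (newInterval i 4)) =
      ∑ v, MvPolynomial.C (c i v) * MvPolynomial.X (newInterval i v) := by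
    simp only [Fin.sum_univ_five]
    rfl
  rw [Fintype.linearCombination_apply, map_sum, Fintype.sum_prod_type]
  simp only [map_smul, symbolMap_consequence, hrename, MvPolynomial.smul_eq_C_mul, ← mul_assoc,
    ← Finset.sum_mul, ← hrow, Fin.sum_univ_four]
  rfl

theorem mem_relations_iff {F : Type*} [Field F] {a : Fin 10 → F} {c : Fin 4 → Fin 5 → F} :
    c ∈ relations a ↔
      relationForm (fun k => MvPolynomial.C (a k)) (fun i v => MvPolynomial.C (c i v))
        (MvPolynomial.X (0, 3)) (MvPolynomial.X (0, 1)) (MvPolynomial.X (1, 2))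
        (MvPolynomial.X (2, 3)) (MvPolynomial.X (0, 2))
        (MvPolynomial.X (1, 3) : MvPolynomial (ℕ × ℕ) F) = 0 := by
  have hsupp : Fintype.linearCombination F (consequence a) (fun x => c x.1 x.2) ∈
      Finsupp.supported F F {m : OpMon | m.degree = 3} :=
    Submodule.sum_mem _ fun x _ => Submodule.smul_mem _ _
      (Finsupp.supported_mono (fun _ h => h.1) (consequence_mem_supported a x))
  rw [← symbolMap_linearCombination_consequence, symbolMap_eq_zero_iff hsupp]
  rfl

theorem relationForm_eq_zero {F A : Type*} [Field F] [CommRing A] [Algebra F A]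
    {a : Fin 10 → F} {c : Fin 4 → Fin 5 → F} (h : c ∈ relations a) (u r s t p q : A) :
    relationForm (fun k => algebraMap F A (a k)) (fun i v => algebraMap F A (c i v))
      u r s t p q = 0 := by
  have hφ := congrArg (MvPolynomial.aeval fun P : ℕ × ℕ =>
    if P = (0, 3) then u else if P = (0, 1) then r else if P = (1, 2) then s else
      if P = (2, 3) then t else if P = (0, 2) then p else q) (mem_relations_iff.1 h)
  simpa [relationForm, linearForm, cubic] using hφ

end RelationForm

section CoefficientEquations

variable {F : Type*} [Field F]

/-- The vanishing of the coefficients of `relationForm a c u r s t p 0` at monomials divisible by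
`p`.  Each field is named after its monomial. -/
structure ShortIntervalEquations (a : Fin 10 → F) (c : Fin 4 → Fin 5 → F) : Prop where
  p4 : c 0 4 * a 3 + a 0 * c 2 4 = 0
  up3 : c 0 3 * a 3 + c 0 4 * a 2 + a 0 * c 2 3 = 0
  rp3 : c 0 0 * a 3 + a 0 * c 2 0 + a 1 * c 2 4 = 0
  sp3 : c 0 1 * a 3 + a 0 * c 2 1 + a 4 * c 2 4 = 0
  tp3 : c 0 2 * a 3 + c 0 4 * a 6 + a 0 * c 2 2 = 0
  u2p2 : c 0 3 * a 2 + c 0 4 * a 1 = 0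
  urp2 : c 0 0 * a 2 + a 1 * c 2 3 = 0
  usp2 : c 0 1 * a 2 + a 4 * c 2 3 = 0
  utp2 : c 0 2 * a 2 + c 0 3 * a 6 + c 0 4 * a 5 = 0
  r2p2 : a 1 * c 2 0 + a 2 * c 2 4 = 0
  rsp2 : a 1 * c 2 1 + a 4 * c 2 0 + a 5 * c 2 4 = 0
  rtp2 : c 0 0 * a 6 + a 1 * c 2 2 = 0
  s2p2 : a 4 * c 2 1 + a 7 * c 2 4 = 0
  stp2 : c 0 1 * a 6 + a 4 * c 2 2 = 0
  t2p2 : c 0 2 * a 6 + c 0 4 * a 8 = 0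
  u3p : c 0 3 * a 1 + c 0 4 * a 0 = 0
  u2rp : c 0 0 * a 1 = 0
  u2sp : c 0 1 * a 1 = 0
  u2tp : c 0 2 * a 1 + c 0 3 * a 5 + c 0 4 * a 4 = 0
  ur2p : a 2 * c 2 3 = 0
  ursp : a 5 * c 2 3 = 0
  urtp : c 0 0 * a 5 = 0
  us2p : a 7 * c 2 3 = 0
  ustp : c 0 1 * a 5 = 0
  ut2p : c 0 2 * a 5 + c 0 3 * a 8 + c 0 4 * a 7 = 0
  r3p : a 2 * c 2 0 + a 3 * c 2 4 = 0
  r2sp : a 2 * c 2 1 + a 5 * c 2 0 + a 6 * c 2 4 = 0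
  r2tp : a 2 * c 2 2 = 0
  rs2p : a 5 * c 2 1 + a 7 * c 2 0 + a 8 * c 2 4 = 0
  rstp : a 5 * c 2 2 = 0
  rt2p : c 0 0 * a 8 = 0
  s3p : a 7 * c 2 1 + a 9 * c 2 4 = 0
  s2tp : a 7 * c 2 2 = 0
  st2p : c 0 1 * a 8 = 0
  t3p : c 0 2 * a 8 + c 0 4 * a 9 = 0

/-- The vanishing of the coefficients of `relationForm a c u r s t 0 0`.  Each field is named after
its monomial. -/
structure ConstantEquations (a : Fin 10 → F) (c : Fin 4 → Fin 5 → F) : Prop where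
  u4 : c 0 3 * a 0 + a 0 * c 1 3 = 0
  u3r : c 0 0 * a 0 + a 0 * c 1 0 + a 1 * c 1 3 = 0
  u3s : c 0 1 * a 0 + a 0 * c 1 1 = 0
  u3t : c 0 2 * a 0 + c 0 3 * a 4 + a 0 * c 1 2 = 0
  u2r2 : a 1 * c 1 0 + a 2 * c 1 3 = 0
  u2rs : a 1 * c 1 1 = 0
  u2rt : c 0 0 * a 4 + a 1 * c 1 2 = 0
  ur3 : a 2 * c 1 0 + a 3 * c 1 3 + a 3 * c 2 3 = 0
  ur2s : a 2 * c 1 1 + a 6 * c 2 3 = 0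
  ur2t : a 2 * c 1 2 = 0
  us3 : a 3 * c 3 3 + a 9 * c 2 3 = 0
  us2t : a 6 * c 3 3 = 0
  ut3 : c 0 2 * a 7 + c 0 3 * a 9 + a 9 * c 3 3 = 0
  r4 : a 3 * c 1 0 + a 3 * c 2 0 = 0
  r3s : a 3 * c 1 1 + a 3 * c 2 1 + a 6 * c 2 0 = 0
  r3t : a 3 * c 1 2 + a 3 * c 2 2 = 0
  r2s2 : a 6 * c 2 1 + a 8 * c 2 0 = 0
  r2st : a 6 * c 2 2 = 0
  rs3 : a 3 * c 3 0 + a 8 * c 2 1 + a 9 * c 2 0 = 0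
  rs2t : a 6 * c 3 0 + a 8 * c 2 2 = 0
  rt3 : c 0 0 * a 9 + a 9 * c 3 0 = 0
  s4 : a 3 * c 3 1 + a 9 * c 2 1 = 0
  s3t : a 3 * c 3 2 + a 6 * c 3 1 + a 9 * c 2 2 = 0
  s2t2 : a 6 * c 3 2 + a 8 * c 3 1 = 0
  st3 : c 0 1 * a 9 + a 8 * c 3 2 + a 9 * c 3 1 = 0
  t4 : c 0 2 * a 9 + a 9 * c 3 2 = 0

variable {a : Fin 10 → F} {c : Fin 4 → Fin 5 → F}

set_option maxHeartbeats 300000 in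
-- One simplifier call for each of the thirty-five coefficients.
open Polynomial in
theorem shortIntervalEquations_of_mem_relations (h : c ∈ relations a) :
    ShortIntervalEquations a c := by
  -- Kronecker substitution: in degree at most `4`, base `5` separates the monomials.
  have key := relationForm_eq_zero (A := F[X]) h 1 X (X ^ 5) (X ^ 25) (X ^ 125) 0
  have hcoeff (i j k l : ℕ) := congrArg (coeff · (i + 5 * j + 25 * k + 125 * l)) key
  simp only [relationForm, linearForm, cubic, algebraMap_eq] at hcoeff
  ring_nf at hcoeff
  simp only [coeff_add, coeff_mul_C, coeff_X_pow, coeff_zero] at hcoeff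
  exact {
    p4 := by simpa [coeff_X, coeff_C] using hcoeff 0 0 0 4
    up3 := by simpa [coeff_X, coeff_C] using hcoeff 0 0 0 3
    rp3 := by simpa [coeff_X, coeff_C] using hcoeff 1 0 0 3
    sp3 := by simpa [coeff_X, coeff_C] using hcoeff 0 1 0 3
    tp3 := by simpa [coeff_X, coeff_C] using hcoeff 0 0 1 3
    u2p2 := by simpa [coeff_X, coeff_C] using hcoeff 0 0 0 2
    urp2 := by simpa [coeff_X, coeff_C] using hcoeff 1 0 0 2
    usp2 := by simpa [coeff_X, coeff_C] using hcoeff 0 1 0 2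
    utp2 := by simpa [coeff_X, coeff_C] using hcoeff 0 0 1 2
    r2p2 := by simpa [coeff_X, coeff_C] using hcoeff 2 0 0 2
    rsp2 := by simpa [coeff_X, coeff_C] using hcoeff 1 1 0 2
    rtp2 := by simpa [coeff_X, coeff_C] using hcoeff 1 0 1 2
    s2p2 := by simpa [coeff_X, coeff_C] using hcoeff 0 2 0 2
    stp2 := by simpa [coeff_X, coeff_C] using hcoeff 0 1 1 2
    t2p2 := by simpa [coeff_X, coeff_C] using hcoeff 0 0 2 2
    u3p := by simpa [coeff_X, coeff_C] using hcoeff 0 0 0 1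
    u2rp := by simpa [coeff_X, coeff_C] using hcoeff 1 0 0 1
    u2sp := by simpa [coeff_X, coeff_C] using hcoeff 0 1 0 1
    u2tp := by simpa [coeff_X, coeff_C] using hcoeff 0 0 1 1
    ur2p := by simpa [coeff_X, coeff_C] using hcoeff 2 0 0 1
    ursp := by simpa [coeff_X, coeff_C] using hcoeff 1 1 0 1
    urtp := by simpa [coeff_X, coeff_C] using hcoeff 1 0 1 1
    us2p := by simpa [coeff_X, coeff_C] using hcoeff 0 2 0 1
    ustp := by simpa [coeff_X, coeff_C] using hcoeff 0 1 1 1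
    ut2p := by simpa [coeff_X, coeff_C] using hcoeff 0 0 2 1
    r3p := by simpa [coeff_X, coeff_C] using hcoeff 3 0 0 1
    r2sp := by simpa [coeff_X, coeff_C] using hcoeff 2 1 0 1
    r2tp := by simpa [coeff_X, coeff_C] using hcoeff 2 0 1 1
    rs2p := by simpa [coeff_X, coeff_C] using hcoeff 1 2 0 1
    rstp := by simpa [coeff_X, coeff_C] using hcoeff 1 1 1 1
    rt2p := by simpa [coeff_X, coeff_C] using hcoeff 1 0 2 1
    s3p := by simpa [coeff_X, coeff_C] using hcoeff 0 3 0 1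
    s2tp := by simpa [coeff_X, coeff_C] using hcoeff 0 2 1 1
    st2p := by simpa [coeff_X, coeff_C] using hcoeff 0 1 2 1
    t3p := by simpa [coeff_X, coeff_C] using hcoeff 0 0 3 1
  }

open Polynomial in
theorem constantEquations_of_mem_relations (h : c ∈ relations a) :
    ConstantEquations a c := by
  have key := relationForm_eq_zero (A := F[X]) h 1 X (X ^ 5) (X ^ 25) 0 0
  have hcoeff (i j k : ℕ) := congrArg (coeff · (i + 5 * j + 25 * k)) key
  simp only [relationForm, linearForm, cubic, algebraMap_eq] at hcoeff
  ring_nf at hcoeff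
  simp only [coeff_add, coeff_mul_C, coeff_X_pow, coeff_zero] at hcoeff
  exact {
    u4 := by simpa [coeff_X, coeff_C] using hcoeff 0 0 0
    u3r := by simpa [coeff_X, coeff_C] using hcoeff 1 0 0
    u3s := by simpa [coeff_X, coeff_C] using hcoeff 0 1 0
    u3t := by simpa [coeff_X, coeff_C] using hcoeff 0 0 1
    u2r2 := by simpa [coeff_X, coeff_C] using hcoeff 2 0 0
    u2rs := by simpa [coeff_X, coeff_C] using hcoeff 1 1 0
    u2rt := by simpa [coeff_X, coeff_C] using hcoeff 1 0 1
    ur3 := by simpa [coeff_X, coeff_C] using hcoeff 3 0 0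
    ur2s := by simpa [coeff_X, coeff_C] using hcoeff 2 1 0
    ur2t := by simpa [coeff_X, coeff_C] using hcoeff 2 0 1
    us3 := by simpa [coeff_X, coeff_C] using hcoeff 0 3 0
    us2t := by simpa [coeff_X, coeff_C] using hcoeff 0 2 1
    ut3 := by simpa [coeff_X, coeff_C] using hcoeff 0 0 3
    r4 := by simpa [coeff_X, coeff_C] using hcoeff 4 0 0
    r3s := by simpa [coeff_X, coeff_C] using hcoeff 3 1 0
    r3t := by simpa [coeff_X, coeff_C] using hcoeff 3 0 1
    r2s2 := by simpa [coeff_X, coeff_C] using hcoeff 2 2 0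
    r2st := by simpa [coeff_X, coeff_C] using hcoeff 2 1 1
    rs3 := by simpa [coeff_X, coeff_C] using hcoeff 1 3 0
    rs2t := by simpa [coeff_X, coeff_C] using hcoeff 1 2 1
    rt3 := by simpa [coeff_X, coeff_C] using hcoeff 1 0 3
    s4 := by simpa [coeff_X, coeff_C] using hcoeff 0 4 0
    s3t := by simpa [coeff_X, coeff_C] using hcoeff 0 3 1
    s2t2 := by simpa [coeff_X, coeff_C] using hcoeff 0 2 2
    st3 := by simpa [coeff_X, coeff_C] using hcoeff 0 1 3
    t4 := by simpa [coeff_X, coeff_C] using hcoeff 0 0 4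
  }

end CoefficientEquations

section Mirror

variable {F : Type*} [Field F]

/-- The permutation of the ten coefficients that corresponds to reading words from right to
left. -/
def reverseIndex : Fin 10 → Fin 10 := ![0, 4, 7, 9, 1, 5, 8, 2, 6, 3]

theorem reverseIndex_involutive : Function.Involutive reverseIndex := by
  unfold Function.Involutive
  decide

/-- The effect on the coefficients of a linear combination of consequences of reading words from
right to left. -/
def mirror (F : Type*) [Field F] : (Fin 4 → Fin 5 → F) ≃ₗ[F] (Fin 4 → Fin 5 → F) :=
  LinearEquiv.ofInvolutive
    { toFun := fun c i v => c (![1, 0, 3, 2] i) (![2, 1, 0, 3, 4] v)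
      map_add' := fun _ _ => rfl
      map_smul' := fun _ _ => rfl }
    fun c => by
      ext i v
      fin_cases i <;> fin_cases v <;> rfl

theorem mirror_apply (c : Fin 4 → Fin 5 → F) (i : Fin 4) (v : Fin 5) :
    mirror F c i v = c (![1, 0, 3, 2] i) (![2, 1, 0, 3, 4] v) := rfl

theorem relationForm_mirror {R : Type*} [CommRing R] (a : Fin 10 → R) (c : Fin 4 → Fin 5 → R)
    (u r s t p q : R) :
    relationForm (a ∘ reverseIndex) (fun i v => c (![1, 0, 3, 2] i) (![2, 1, 0, 3, 4] v))
      u r s t p q = relationForm a c u t s r q p := by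
  simp only [relationForm, linearForm, cubic, reverseIndex, Function.comp_apply,
    Matrix.cons_val]
  ring

theorem mirror_mem_relations {a : Fin 10 → F} {c : Fin 4 → Fin 5 → F} (h : c ∈ relations a) :
    mirror F c ∈ relations (a ∘ reverseIndex) :=
  mem_relations_iff.2 ((relationForm_mirror (fun k => MvPolynomial.C (a k))
    (fun i v => MvPolynomial.C (c i v)) _ _ _ _ _ _).trans (relationForm_eq_zero h _ _ _ _ _ _))

theorem map_mirror_relations (a : Fin 10 → F) :
    (relations a).map (mirror F).toLinearMap = relations (a ∘ reverseIndex) := by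
  refine le_antisymm (Submodule.map_le_iff_le_comap.2 fun c => mirror_mem_relations)
    fun c hc => ⟨mirror F c, ?_, (mirror F).symm_apply_apply c⟩
  have hmem := mirror_mem_relations hc
  rwa [Function.comp_assoc, reverseIndex_involutive.comp_self, Function.comp_id] at hmem

theorem finrank_relations_comp_reverseIndex (a : Fin 10 → F) :
    Module.finrank F (relations (a ∘ reverseIndex)) = Module.finrank F (relations a) := by
  rw [← map_mirror_relations, LinearEquiv.finrank_map_eq (mirror F)]

theorem relations_comp_reverseIndex_eq_bot_iff {a : Fin 10 → F} :
    relations (a ∘ reverseIndex) = ⊥ ↔ relations a = ⊥ := by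
  rw [← map_mirror_relations, Submodule.map_eq_bot_iff]

end Mirror

section Classification

variable {F : Type*} [Field F] {a : Fin 10 → F} {c : Fin 4 → Fin 5 → F}

theorem row_eq_zero {x : Fin 5 → F} (h0 : x 0 = 0) (h1 : x 1 = 0) (h2 : x 2 = 0) (h3 : x 3 = 0)
    (h4 : x 4 = 0) : x = 0 := by
  ext v
  fin_cases v <;> assumption

theorem eq_zero_of_rows {c : Fin 4 → Fin 5 → F} (h0 : c 0 = 0) (h1 : c 1 = 0) (h2 : c 2 = 0)
    (h3 : c 3 = 0) : c = 0 := by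
  ext i : 1
  fin_cases i <;> assumption

theorem mul_eq_zero_of_mul_add_mul_eq_zero {α β x y : F} (hx : α * x = 0)
    (hxy : α * y + β * x = 0) : β * x = 0 :=
  pow_eq_zero_iff two_ne_zero |>.1 (by linear_combination β * x * hxy - β * y * hx)

theorem row_two_eq_zero (h : c ∈ relations a) (h1 : a 1 = 0) (h4 : a 4 = 0)
    (ha : a 2 ≠ 0 ∨ a 5 ≠ 0 ∨ a 7 ≠ 0) : c 2 = 0 := by
  have e := shortIntervalEquations_of_mem_relations h
  have h24 : c 2 4 = 0 := by
    rcases ha with h2 | h5 | h7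
    · simpa [h1, h2] using e.r2p2
    · simpa [h1, h4, h5] using e.rsp2
    · simpa [h4, h7] using e.s2p2
  have h23 : c 2 3 = 0 := by
    rcases ha with h2 | h5 | h7
    exacts [(mul_eq_zero_iff_left h2).1 e.ur2p, (mul_eq_zero_iff_left h5).1 e.ursp,
      (mul_eq_zero_iff_left h7).1 e.us2p]
  have h22 : c 2 2 = 0 := by
    rcases ha with h2 | h5 | h7
    exacts [(mul_eq_zero_iff_left h2).1 e.r2tp, (mul_eq_zero_iff_left h5).1 e.rstp,
      (mul_eq_zero_iff_left h7).1 e.s2tp]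
  have h201 : c 2 0 = 0 ∧ c 2 1 = 0 := by
    by_cases h2 : a 2 = 0
    · by_cases h7 : a 7 = 0
      · have h5 : a 5 ≠ 0 := by tauto
        exact ⟨by simpa [h2, h24, h5] using e.r2sp, by simpa [h7, h24, h5] using e.rs2p⟩
      · have h21 : c 2 1 = 0 := by simpa [h7, h24] using e.s3p
        exact ⟨by simpa [h21, h24, h7] using e.rs2p, h21⟩
    · have h20 : c 2 0 = 0 := by simpa [h2, h24] using e.r3p
      exact ⟨h20, by simpa [h20, h24, h2] using e.r2sp⟩
  exact row_eq_zero h201.1 h201.2 h22 h23 h24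

theorem row_three_eq_zero (h : c ∈ relations a) (h1 : a 1 = 0) (h4 : a 4 = 0)
    (ha : a 2 ≠ 0 ∨ a 5 ≠ 0 ∨ a 7 ≠ 0) : c 3 = 0 := by
  have hrow : mirror F c 2 = 0 :=
    row_two_eq_zero (mirror_mem_relations h) h4 h1 (by tauto : a 7 ≠ 0 ∨ a 5 ≠ 0 ∨ a 2 ≠ 0)
  exact row_eq_zero (congrFun hrow 2) (congrFun hrow 1) (congrFun hrow 0) (congrFun hrow 3)
    (congrFun hrow 4)

theorem eq_zero_of_two_ne_zero (h : c ∈ relations a) (h1 : a 1 = 0) (h4 : a 4 = 0)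
    (h2 : a 2 ≠ 0) : c = 0 := by
  have e := shortIntervalEquations_of_mem_relations h
  have e₀ := constantEquations_of_mem_relations h
  have hc2 := row_two_eq_zero h h1 h4 (.inl h2)
  have h03 : c 0 3 = 0 := by simpa [h1, h2] using e.u2p2
  have h04 : c 0 4 = 0 := by simpa [h03, hc2, h2] using e.up3
  have hc0 : c 0 = 0 := row_eq_zero (by simpa [h1, h2] using e.urp2)
    (by simpa [h4, h2] using e.usp2) (by simpa [h03, h04, h2] using e.utp2) h03 h04
  have h13 : c 1 3 = 0 := by simpa [h1, h2] using e₀.u2r2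
  have h10 : c 1 0 = 0 := by simpa [h13, hc2, h2] using e₀.ur3
  have hut2p : c 1 0 * a 5 + c 1 3 * a 6 + c 1 4 * a 2 = 0 :=
    (shortIntervalEquations_of_mem_relations (mirror_mem_relations h)).ut2p
  have hc1 : c 1 = 0 := row_eq_zero h10 (by simpa [hc2, h2] using e₀.ur2s)
    (by simpa [h2] using e₀.ur2t) h13 (by simpa [h10, h13, h2] using hut2p)
  exact eq_zero_of_rows hc0 hc1 hc2 (row_three_eq_zero h h1 h4 (.inl h2))

theorem eq_zero_of_seven_ne_zero (h : c ∈ relations a) (h1 : a 1 = 0) (h4 : a 4 = 0)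
    (h7 : a 7 ≠ 0) : c = 0 :=
  (mirror F).map_eq_zero_iff.1 (eq_zero_of_two_ne_zero (mirror_mem_relations h) h4 h1 h7)

theorem row_zero_eq_zero_of_five_ne_zero (h : c ∈ relations a) (h1 : a 1 = 0) (h2 : a 2 = 0)
    (h4 : a 4 = 0) (h7 : a 7 = 0) (h5 : a 5 ≠ 0) : c 0 = 0 := by
  have e := shortIntervalEquations_of_mem_relations h
  have h03 : c 0 3 = 0 := by simpa [h1, h4, h5] using e.u2tp
  exact row_eq_zero (by simpa [h5] using e.urtp) (by simpa [h5] using e.ustp)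
    (by simpa [h03, h5, h7] using e.ut2p) h03 (by simpa [h2, h03, h5] using e.utp2)

theorem eq_zero_of_five_ne_zero (h : c ∈ relations a) (h1 : a 1 = 0) (h2 : a 2 = 0)
    (h4 : a 4 = 0) (h7 : a 7 = 0) (h5 : a 5 ≠ 0) : c = 0 := by
  have hrow : mirror F c 0 = 0 :=
    row_zero_eq_zero_of_five_ne_zero (mirror_mem_relations h) h4 h7 h1 h2 h5
  have hc1 : c 1 = 0 := row_eq_zero (congrFun hrow 2) (congrFun hrow 1) (congrFun hrow 0)
    (congrFun hrow 3) (congrFun hrow 4)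
  exact eq_zero_of_rows (row_zero_eq_zero_of_five_ne_zero h h1 h2 h4 h7 h5) hc1
    (row_two_eq_zero h h1 h4 (.inr (.inl h5))) (row_three_eq_zero h h1 h4 (.inr (.inl h5)))

theorem row_zero_eq_zero_of_six_ne_zero (h : c ∈ relations a) (h1 : a 1 = 0) (h2 : a 2 = 0)
    (h4 : a 4 = 0) (h5 : a 5 = 0) (h6 : a 6 ≠ 0) : c 0 = 0 := by
  have e := shortIntervalEquations_of_mem_relations h
  have h24 : c 2 4 = 0 := by simpa [h2, h5, h6] using e.r2sp
  have h22 : c 2 2 = 0 := by simpa [h6] using (constantEquations_of_mem_relations h).r2st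
  have h04 : c 0 4 = 0 := by
    have hp4 : a 3 * c 0 4 = 0 := by simpa [h24, mul_comm] using e.p4
    have htp3 : a 3 * c 0 2 + a 6 * c 0 4 = 0 := by simpa [h22, mul_comm] using e.tp3
    exact (mul_eq_zero_iff_left h6).1 (mul_eq_zero_of_mul_add_mul_eq_zero hp4 htp3)
  exact row_eq_zero (by simpa [h1, h6] using e.rtp2) (by simpa [h4, h6] using e.stp2)
    (by simpa [h04, h6] using e.t2p2) (by simpa [h2, h5, h6] using e.utp2) h04

theorem row_one_eq_zero_of_six_ne_zero (h : c ∈ relations a) (h2 : a 2 = 0) (h5 : a 5 = 0)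
    (h6 : a 6 ≠ 0) : c 1 = 0 := by
  have e₀ := constantEquations_of_mem_relations h
  have e := shortIntervalEquations_of_mem_relations (mirror_mem_relations h)
  have h22 : c 2 2 = 0 := by simpa [h6] using e₀.r2st
  have h30 : c 3 0 = 0 := by simpa [h22, h6] using e₀.rs2t
  have hut2p : c 1 0 * a 5 + c 1 3 * a 6 + c 1 4 * a 2 = 0 := e.ut2p
  have hst2p : c 1 1 * a 6 = 0 := e.st2p
  have hrt2p : c 1 2 * a 6 = 0 := e.rt2p
  have ht3p : c 1 0 * a 6 + c 1 4 * a 3 = 0 := e.t3p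
  have h14 : c 1 4 = 0 := by
    have hrs2p : a 5 * c 3 1 + a 2 * c 3 2 + a 6 * c 3 4 = 0 := e.rs2p
    have h34 : c 3 4 = 0 := by simpa [h2, h5, h6] using hrs2p
    have hp4 : c 1 4 * a 9 + a 0 * c 3 4 = 0 := e.p4
    have htp3 : c 1 0 * a 9 + c 1 4 * a 8 + a 0 * c 3 0 = 0 := e.tp3
    have ht2p2 : c 1 0 * a 8 + c 1 4 * a 6 = 0 := e.t2p2
    have h9 : a 9 * c 1 4 = 0 := by linear_combination hp4 - a 0 * h34
    have h8 : a 8 * c 1 4 = 0 := mul_eq_zero_of_mul_add_mul_eq_zero (y := c 1 0) h9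
      (by linear_combination htp3 - a 0 * h30)
    exact (mul_eq_zero_iff_left h6).1 (mul_eq_zero_of_mul_add_mul_eq_zero (y := c 1 0) h8
      (by linear_combination ht2p2))
  exact row_eq_zero (by simpa [h14, h6] using ht3p) (by simpa [h6] using hst2p)
    (by simpa [h6] using hrt2p) (by simpa [h2, h5, h6] using hut2p) h14

theorem eq_zero_of_six_ne_zero (h : c ∈ relations a) (h1 : a 1 = 0) (h2 : a 2 = 0)
    (h4 : a 4 = 0) (h5 : a 5 = 0) (h6 : a 6 ≠ 0) : c = 0 := by
  have e₀ := constantEquations_of_mem_relations h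
  have hc1 := row_one_eq_zero_of_six_ne_zero h h2 h5 h6
  have h22 : c 2 2 = 0 := by simpa [h6] using e₀.r2st
  have h20 : c 2 0 = 0 := (mul_eq_zero_iff_left h6).1 <|
    mul_eq_zero_of_mul_add_mul_eq_zero (α := a 3) (y := c 2 1) (by simpa [hc1] using e₀.r4)
      (by simpa [hc1] using e₀.r3s)
  have h21 : c 2 1 = 0 := by simpa [h20, h6] using e₀.r2s2
  have h24 : c 2 4 = 0 := by
    simpa [h2, h5, h6] using (shortIntervalEquations_of_mem_relations h).r2sp
  have hc2 : c 2 = 0 := row_eq_zero h20 h21 h22 (by simpa [h2, h6] using e₀.ur2s) h24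
  have h31 : c 3 1 = 0 := (mul_eq_zero_iff_left h6).1 <|
    mul_eq_zero_of_mul_add_mul_eq_zero (α := a 3) (y := c 3 2) (by simpa [hc2] using e₀.s4)
      (by simpa [hc2] using e₀.s3t)
  have hrs2p : a 5 * c 3 1 + a 2 * c 3 2 + a 6 * c 3 4 = 0 :=
    (shortIntervalEquations_of_mem_relations (mirror_mem_relations h)).rs2p
  have hc3 : c 3 = 0 := row_eq_zero (by simpa [h22, h6] using e₀.rs2t) h31
    (by simpa [h31, h6] using e₀.s2t2) (by simpa [h6] using e₀.us2t)
    (by simpa [h2, h5, h6] using hrs2p)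
  exact eq_zero_of_rows (row_zero_eq_zero_of_six_ne_zero h h1 h2 h4 h5 h6) hc1 hc2 hc3

theorem eq_zero_of_eight_ne_zero (h : c ∈ relations a) (h1 : a 1 = 0) (h4 : a 4 = 0)
    (h5 : a 5 = 0) (h7 : a 7 = 0) (h8 : a 8 ≠ 0) : c = 0 :=
  (mirror F).map_eq_zero_iff.1
    (eq_zero_of_six_ne_zero (mirror_mem_relations h) h4 h7 h1 h5 h8)

/-- The coefficients `α`, `β`, `γ` of `L³(∗∗)`, `L³(∗)∗`, `∗L³(∗)`. -/
def diagonalCoeff (α β γ : F) : Fin 10 → F := ![α, 0, 0, β, 0, 0, 0, 0, 0, γ]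

theorem relations_eq_bot_of_ne_diagonalCoeff (h1 : a 1 = 0) (h4 : a 4 = 0)
    (ha : a ≠ diagonalCoeff (a 0) (a 3) (a 9)) : relations a = ⊥ := by
  refine (Submodule.eq_bot_iff _).2 fun c hc => ?_
  by_cases h2 : a 2 = 0
  · by_cases h7 : a 7 = 0
    · by_cases h5 : a 5 = 0
      · by_cases h6 : a 6 = 0
        · have h8 : a 8 ≠ 0 := fun h8 => ha <| by
            ext k
            fin_cases k <;> first | rfl | assumption
          exact eq_zero_of_eight_ne_zero hc h1 h4 h5 h7 h8
        · exact eq_zero_of_six_ne_zero hc h1 h2 h4 h5 h6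
      · exact eq_zero_of_five_ne_zero hc h1 h2 h4 h7 h5
    · exact eq_zero_of_seven_ne_zero hc h1 h4 h7
  · exact eq_zero_of_two_ne_zero hc h1 h4 h2

theorem row_one_eq_zero_of_one_ne_zero (h : c ∈ relations a) (h1 : a 1 ≠ 0) (hc0 : c 0 = 0) :
    c 1 = 0 := by
  have e₀ := constantEquations_of_mem_relations h
  have hu2tp : c 1 0 * a 4 + c 1 3 * a 5 + c 1 4 * a 1 = 0 :=
    (shortIntervalEquations_of_mem_relations (mirror_mem_relations h)).u2tp
  have h13 : c 1 3 = 0 := (mul_eq_zero_iff_left h1).1 <|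
    mul_eq_zero_of_mul_add_mul_eq_zero (α := a 0) (y := c 1 0) (by simpa [hc0] using e₀.u4)
      (by simpa [hc0] using e₀.u3r)
  have h10 : c 1 0 = 0 := by simpa [h13, h1] using e₀.u2r2
  exact row_eq_zero h10 (by simpa [h1] using e₀.u2rs) (by simpa [hc0, h1] using e₀.u2rt) h13
    (by simpa [h10, h13, h1] using hu2tp)

theorem row_two_eq_zero_of_one_ne_zero (h : c ∈ relations a) (h1 : a 1 ≠ 0) (hc0 : c 0 = 0) :
    c 2 = 0 := by
  have e := shortIntervalEquations_of_mem_relations h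
  have h24 : c 2 4 = 0 := (mul_eq_zero_iff_left h1).1 <|
    mul_eq_zero_of_mul_add_mul_eq_zero (α := a 0) (y := c 2 0) (by simpa [hc0] using e.p4)
      (by simpa [hc0] using e.rp3)
  have h20 : c 2 0 = 0 := by simpa [h24, h1] using e.r2p2
  exact row_eq_zero h20 (by simpa [h20, h24, h1] using e.rsp2)
    (by simpa [hc0, h1] using e.rtp2) (by simpa [hc0, h1] using e.urp2) h24

theorem row_three_eq_zero_of_one_ne_zero (h : c ∈ relations a) (h1 : a 1 ≠ 0) (hc1 : c 1 = 0) :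
    c 3 = 0 := by
  have e := shortIntervalEquations_of_mem_relations (mirror_mem_relations h)
  have hp4 : c 1 4 * a 9 + a 0 * c 3 4 = 0 := e.p4
  have hsp3 : c 1 1 * a 9 + a 0 * c 3 1 + a 1 * c 3 4 = 0 := e.sp3
  have hs2p2 : a 1 * c 3 1 + a 2 * c 3 4 = 0 := e.s2p2
  have hrsp2 : a 4 * c 3 1 + a 1 * c 3 2 + a 5 * c 3 4 = 0 := e.rsp2
  have hstp2 : c 1 1 * a 8 + a 1 * c 3 0 = 0 := e.stp2
  have husp2 : c 1 1 * a 7 + a 1 * c 3 3 = 0 := e.usp2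
  have h34 : c 3 4 = 0 := (mul_eq_zero_iff_left h1).1 <|
    mul_eq_zero_of_mul_add_mul_eq_zero (α := a 0) (y := c 3 1) (by simpa [hc1] using hp4)
      (by simpa [hc1] using hsp3)
  have h31 : c 3 1 = 0 := by simpa [h34, h1] using hs2p2
  exact row_eq_zero (by simpa [hc1, h1] using hstp2) h31 (by simpa [h31, h34, h1] using hrsp2)
    (by simpa [hc1, h1] using husp2) h34

theorem eq_zero_of_one_ne_zero (h : c ∈ relations a) (h1 : a 1 ≠ 0) (h04 : c 0 4 = 0) :
    c = 0 := by
  have e := shortIntervalEquations_of_mem_relations h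
  have h03 : c 0 3 = 0 := by simpa [h04, h1] using e.u3p
  have hc0 : c 0 = 0 := row_eq_zero (by simpa [h1] using e.u2rp) (by simpa [h1] using e.u2sp)
    (by simpa [h03, h04, h1] using e.u2tp) h03 h04
  have hc1 := row_one_eq_zero_of_one_ne_zero h h1 hc0
  exact eq_zero_of_rows hc0 hc1 (row_two_eq_zero_of_one_ne_zero h h1 hc0)
    (row_three_eq_zero_of_one_ne_zero h h1 hc1)

theorem leading_coefficients (h : c ∈ relations a) (h0 : a 0 = 1) (h1 : a 1 ≠ 0) :
    c 0 0 = 0 ∧ c 0 4 = -(a 1 * c 0 3) ∧ c 2 4 = -(a 3 * c 0 4) ∧ c 2 0 = -(a 1 * c 2 4) := by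
  have e := shortIntervalEquations_of_mem_relations h
  have h00 : c 0 0 = 0 := by simpa [h1] using e.u2rp
  exact ⟨h00, by linear_combination e.u3p - c 0 4 * h0, by linear_combination e.p4 - c 2 4 * h0,
    by linear_combination e.rp3 - c 2 0 * h0 - a 3 * h00⟩

theorem coeff_eq_pow_of_one_ne_zero (h : c ∈ relations a) (h0 : a 0 = 1) (h1 : a 1 ≠ 0)
    (h04 : c 0 4 ≠ 0) : a 2 = a 1 ^ 2 ∧ a 3 = a 1 ^ 3 ∧ a 1 ^ 4 = 1 := by
  have e := shortIntervalEquations_of_mem_relations h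
  have e₀ := constantEquations_of_mem_relations h
  obtain ⟨hc00, hc04, hc24, hc20⟩ := leading_coefficients h h0 h1
  have h03 : c 0 3 ≠ 0 := fun h03 => h04 (by rw [hc04, h03, mul_zero, neg_zero])
  have hc23 : c 2 3 = 0 := by simpa [hc00, h1] using e.urp2
  have h2 : a 2 = a 1 ^ 2 := mul_left_cancel₀ h03 (by linear_combination e.u2p2 - a 1 * hc04)
  have h3 : a 3 = a 1 ^ 3 := mul_left_cancel₀ h03 (by
    linear_combination e.up3 - a 2 * hc04 - a 0 * hc23 + c 0 3 * a 1 * h2)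
  have hc13 : c 1 3 = -c 0 3 := by linear_combination e₀.u4 - (c 0 3 + c 1 3) * h0
  have hc10 : c 1 0 = -(a 1 * c 1 3) := by
    linear_combination e₀.u3r - (c 0 0 + c 1 0) * h0 - hc00
  have hsum : c 1 0 + c 2 0 = 0 :=
    (mul_eq_zero_iff_left (h3 ▸ pow_ne_zero 3 h1)).1 (by linear_combination e₀.r4)
  have hpow : (a 1 * c 0 3) * a 1 ^ 4 = (a 1 * c 0 3) * 1 := by
    rw [hc10, hc13, hc20, hc24, hc04, h3] at hsum
    linear_combination -hsum
  exact ⟨h2, h3, mul_left_cancel₀ (mul_ne_zero h1 h03) hpow⟩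

theorem four_eq_zero_of_one_ne_zero (hF : (2 : F) ≠ 0) (h : c ∈ relations a) (h0 : a 0 = 1)
    (h1 : a 1 ≠ 0) (h04 : c 0 4 ≠ 0) : a 4 = 0 := by
  have e := shortIntervalEquations_of_mem_relations h
  obtain ⟨h2, h3, -⟩ := coeff_eq_pow_of_one_ne_zero h h0 h1 h04
  obtain ⟨hc00, hc04, hc24, hc20⟩ := leading_coefficients h h0 h1
  have h03 : c 0 3 ≠ 0 := fun h03 => h04 (by rw [hc04, h03, mul_zero, neg_zero])
  have h24 : c 2 4 ≠ 0 := by simp [hc24, h3, h1, h04]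
  have hc01 : c 0 1 = 0 := by simpa [h1] using e.u2sp
  have hc22 : c 2 2 = 0 := by simpa [hc00, h1] using e.rtp2
  have hc21 : c 2 1 = -(a 4 * c 2 4) := by
    linear_combination e.sp3 - c 2 1 * h0 - a 3 * hc01
  have h5 : a 5 = 2 * a 1 * a 4 := mul_left_cancel₀ h24 (by
    linear_combination e.rsp2 - a 1 * hc21 - a 4 * hc20)
  have hc02 : c 0 2 = -(a 4 * c 0 3) := mul_left_cancel₀ h1 (by
    linear_combination e.u2tp - c 0 3 * h5 - a 4 * hc04)
  have h6 : a 6 = 3 * a 1 ^ 2 * a 4 := mul_left_cancel₀ h03 (by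
    linear_combination e.utp2 - a 2 * hc02 + a 4 * c 0 3 * h2 - a 5 * hc04 + a 1 * c 0 3 * h5)
  have hfour : (2 : F) * 2 * a 1 ^ 3 * c 0 3 * a 4 = 0 := by
    linear_combination -e.tp3 + a 3 * hc02 - a 4 * c 0 3 * h3 + a 6 * hc04 -
      a 1 * c 0 3 * h6 + a 0 * hc22
  simpa [hF, h1, h03] using hfour

/-- The coefficients of `L³(xy) + t L²(L(x)y) + t² L(L²(x)y) + t³ L³(x)y`. -/
def fourTermCoeff {R : Type*} [CommRing R] (t : R) : Fin 10 → R :=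
  ![1, t, t ^ 2, t ^ 3, 0, 0, 0, 0, 0, 0]

theorem eq_fourTermCoeff (hF : (2 : F) ≠ 0) (h : c ∈ relations a) (h0 : a 0 = 1) (h1 : a 1 ≠ 0)
    (h04 : c 0 4 ≠ 0) : a = fourTermCoeff (a 1) := by
  have e := shortIntervalEquations_of_mem_relations h
  obtain ⟨h2, h3, -⟩ := coeff_eq_pow_of_one_ne_zero h h0 h1 h04
  obtain ⟨-, -, hc24, -⟩ := leading_coefficients h h0 h1
  have h4 := four_eq_zero_of_one_ne_zero hF h h0 h1 h04
  have h24 : c 2 4 ≠ 0 := by simp [hc24, h3, h1, h04]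
  have hc01 : c 0 1 = 0 := by simpa [h1] using e.u2sp
  have hc21 : c 2 1 = 0 := by simpa [hc01, h0, h4] using e.sp3
  have h5 : a 5 = 0 := by simpa [hc21, h4, h24] using e.rsp2
  have h6 : a 6 = 0 := by simpa [hc21, h5, h24] using e.r2sp
  have h7 : a 7 = 0 := by simpa [h4, h24] using e.s2p2
  have h8 : a 8 = 0 := by simpa [h5, h7, h24] using e.rs2p
  have h9 : a 9 = 0 := by simpa [h7, h24] using e.s3p
  ext k
  fin_cases k <;> first | rfl | assumption

theorem relations_eq_bot_of_one_ne_zero (hF : (2 : F) ≠ 0) (h0 : a 0 = 0 ∨ a 0 = 1)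
    (h1 : a 1 ≠ 0) (ha : a 1 ^ 4 = 1 → a ≠ fourTermCoeff (a 1)) : relations a = ⊥ := by
  refine (Submodule.eq_bot_iff _).2 fun c hc => eq_zero_of_one_ne_zero hc h1 ?_
  rcases h0 with h0 | h0
  · have e := shortIntervalEquations_of_mem_relations hc
    have h03 : c 0 3 = 0 := by simpa [h0, h1] using e.u3p
    simpa [h03, h1] using e.u2p2
  · by_contra h04
    exact ha (coeff_eq_pow_of_one_ne_zero hc h0 h1 h04).2.2 (eq_fourTermCoeff hF hc h0 h1 h04)

/-- The relation between the consequences of the polynomial with coefficients `fourTermCoeff t`,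
for `t ^ 4 = 1`. -/
def fourTermRelation {R : Type*} [CommRing R] (t : R) : Fin 4 → Fin 5 → R :=
  ![![0, 0, 0, -1, t], ![-t, 0, 0, 1, 0], ![t, 0, 0, 0, -1], 0]

-- Since `(t y - x)(x³ + t x² y + t² x y² + t³ y³) = t⁴ y⁴ - x⁴`, the three rows telescope.
theorem relationForm_fourTermRelation {R : Type*} [CommRing R] {t : R} (ht : t ^ 4 = 1)
    (u x y z p q : R) :
    relationForm (fourTermCoeff t) (fourTermRelation t) u x y z p q = 0 := by
  simp only [relationForm, linearForm, cubic, fourTermRelation, fourTermCoeff, Matrix.cons_val,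
    Pi.zero_apply]
  linear_combination p ^ 4 * ht

theorem fourTermRelation_mem_relations {t : F} (ht : t ^ 4 = 1) :
    fourTermRelation t ∈ relations (fourTermCoeff t) := by
  refine mem_relations_iff.2 ?_
  convert relationForm_fourTermRelation (t := MvPolynomial.C t) (by rw [← map_pow, ht, map_one])
    _ _ _ _ _ _ with k i v
  · fin_cases k <;> simp [fourTermCoeff]
  · fin_cases i <;> fin_cases v <;> simp [fourTermRelation]

theorem relations_fourTermCoeff {t : F} (ht : t ^ 4 = 1) :
    relations (fourTermCoeff t) = Submodule.span F {fourTermRelation t} := by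
  have ht0 : t ≠ 0 := fun h0 => by simp [h0] at ht
  refine le_antisymm (fun c hc => Submodule.mem_span_singleton.2 ⟨t⁻¹ * c 0 4, ?_⟩)
    ((Submodule.span_singleton_le_iff_mem _ _).2 (fourTermRelation_mem_relations ht))
  refine (sub_eq_zero.1 (eq_zero_of_one_ne_zero (Submodule.sub_mem _ hc
    (Submodule.smul_mem _ (t⁻¹ * c 0 4) (fourTermRelation_mem_relations ht))) ht0 ?_)).symm
  simp [fourTermRelation, ht0, mul_right_comm]

theorem finrank_relations_fourTermCoeff {t : F} (ht : t ^ 4 = 1) :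
    Module.finrank F (relations (fourTermCoeff t)) = 1 := by
  rw [relations_fourTermCoeff ht]
  exact finrank_span_singleton fun h0 => by simpa [fourTermRelation] using congrFun₂ h0 0 3

end Classification

section Diagonal

variable {F : Type*} [Field F] {α β γ : F} {c : Fin 4 → Fin 5 → F}

/-- The vectors whose four rows, one for each `degreeStep`, are the multiples by `w` of one and the
same row, with last entry `0`. -/
def tensorRelation (w : Fin 4 → F) : (Fin 4 → F) →ₗ[F] (Fin 4 → Fin 5 → F) where
  toFun x i := w i • ![x 0, x 1, x 2, x 3, 0]
  map_add' x y := by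
    ext i v
    fin_cases v <;> simp [mul_add]
  map_smul' k x := by
    ext i v
    fin_cases v <;> simp [mul_left_comm]

theorem tensorRelation_injective {w : Fin 4 → F} {i : Fin 4} (hw : w i ≠ 0) :
    Function.Injective (tensorRelation w) := fun x y hxy => by
  have hrow := smul_right_injective _ hw (congrFun hxy i)
  ext v
  fin_cases v
  exacts [congrFun hrow 0, congrFun hrow 1, congrFun hrow 2, congrFun hrow 3]

theorem tensorRelation_mem_relations {w : Fin 4 → F} (h01 : α * (w 0 + w 1) = 0)
    (h02 : β * w 0 + α * w 2 = 0) (h03 : γ * (w 0 + w 3) = 0) (h12 : β * (w 1 + w 2) = 0)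
    (h13 : γ * w 1 + α * w 3 = 0) (h23 : γ * w 2 + β * w 3 = 0) (x : Fin 4 → F) :
    tensorRelation w x ∈ relations (diagonalCoeff α β γ) := by
  refine mem_relations_iff.2 ?_
  have hC {y : F} (hy : y = 0) := congrArg (MvPolynomial.C : F → MvPolynomial (ℕ × ℕ) F) hy
  have k01 := hC h01
  have k02 := hC h02
  have k03 := hC h03
  have k12 := hC h12
  have k13 := hC h13
  have k23 := hC h23
  simp only [relationForm, linearForm, cubic, tensorRelation, diagonalCoeff, LinearMap.coe_mk,
    AddHom.coe_mk, Pi.smul_apply, smul_eq_mul, Matrix.cons_val, map_add, map_mul, map_zero] at *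
  set u : MvPolynomial (ℕ × ℕ) F := MvPolynomial.X (0, 3)
  set r : MvPolynomial (ℕ × ℕ) F := MvPolynomial.X (0, 1)
  set s : MvPolynomial (ℕ × ℕ) F := MvPolynomial.X (1, 2)
  set t : MvPolynomial (ℕ × ℕ) F := MvPolynomial.X (2, 3)
  set p : MvPolynomial (ℕ × ℕ) F := MvPolynomial.X (0, 2)
  set q : MvPolynomial (ℕ × ℕ) F := MvPolynomial.X (1, 3)
  linear_combination (MvPolynomial.C (x 0) * r + MvPolynomial.C (x 1) * s +
    MvPolynomial.C (x 2) * t + MvPolynomial.C (x 3) * u) *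
      (u ^ 3 * k01 + p ^ 3 * k02 + t ^ 3 * k03 + r ^ 3 * k12 + q ^ 3 * k13 + s ^ 3 * k23)

theorem last_eq_zero (h : c ∈ relations (diagonalCoeff α β γ)) (hαβ : α ≠ 0 ∨ β ≠ 0)
    (i : Fin 4) : c i 4 = 0 := by
  have e := shortIntervalEquations_of_mem_relations h
  have e' := shortIntervalEquations_of_mem_relations (mirror_mem_relations h)
  have h0 : α = 0 ∨ c 0 4 = 0 := by simpa [diagonalCoeff, or_comm] using e.u3p
  have h1 : α = 0 ∨ c 1 4 = 0 := by
    simpa [diagonalCoeff, or_comm, mirror_apply, reverseIndex] using e'.u3p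
  have h2 : β = 0 ∨ c 2 4 = 0 := by simpa [diagonalCoeff, or_comm] using e.r3p
  have h3 : β = 0 ∨ c 3 4 = 0 := by
    simpa [diagonalCoeff, or_comm, mirror_apply, reverseIndex] using e'.s3p
  have h1' : β = 0 ∨ c 1 4 = 0 := by
    simpa [diagonalCoeff, or_comm, mirror_apply, reverseIndex] using e'.t3p
  have h02 : c 0 4 * β + α * c 2 4 = 0 := e.p4
  have h13 : c 1 4 * γ + α * c 3 4 = 0 := e'.p4
  fin_cases i <;> grind

theorem row_equations (h : c ∈ relations (diagonalCoeff α β γ)) (hc : ∀ i, c i 4 = 0) :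
    α • (c 0 + c 1) = 0 ∧ β • c 0 + α • c 2 = 0 ∧ γ • (c 0 + c 3) = 0 ∧
      β • (c 1 + c 2) = 0 ∧ γ • c 1 + α • c 3 = 0 ∧ β • c 3 + γ • c 2 = 0 := by
  have e := shortIntervalEquations_of_mem_relations h
  have e₀ := constantEquations_of_mem_relations h
  have e' := shortIntervalEquations_of_mem_relations (mirror_mem_relations h)
  refine ⟨row_eq_zero ?_ ?_ ?_ ?_ (by simp [hc]), row_eq_zero ?_ ?_ ?_ ?_ (by simp [hc]),
    row_eq_zero ?_ ?_ ?_ ?_ (by simp [hc]), row_eq_zero ?_ ?_ ?_ ?_ (by simp [hc]),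
    row_eq_zero ?_ ?_ ?_ ?_ (by simp [hc]), row_eq_zero ?_ ?_ ?_ ?_ (by simp [hc])⟩
  · simpa [diagonalCoeff, mul_add, mul_comm] using e₀.u3r
  · simpa [diagonalCoeff, mul_add, mul_comm] using e₀.u3s
  · simpa [diagonalCoeff, mul_add, mul_comm] using e₀.u3t
  · simpa [diagonalCoeff, mul_add, mul_comm] using e₀.u4
  · simpa [diagonalCoeff, mul_add, mul_comm] using e.rp3
  · simpa [diagonalCoeff, mul_add, mul_comm] using e.sp3
  · simpa [diagonalCoeff, mul_add, mul_comm] using e.tp3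
  · simpa [diagonalCoeff, mul_add, mul_comm] using e.up3
  · simpa [diagonalCoeff, mul_add, mul_comm] using e₀.rt3
  · simpa [diagonalCoeff, mul_add, mul_comm] using e₀.st3
  · simpa [diagonalCoeff, mul_add, mul_comm] using e₀.t4
  · simpa [diagonalCoeff, mul_add, mul_comm] using e₀.ut3
  · simpa [diagonalCoeff, mul_add, mul_comm] using e₀.r4
  · simpa [diagonalCoeff, mul_add, mul_comm] using e₀.r3s
  · simpa [diagonalCoeff, mul_add, mul_comm] using e₀.r3t
  · simpa [diagonalCoeff, mul_add, mul_comm] using e₀.ur3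
  · simpa [diagonalCoeff, mul_add, mul_comm, mirror_apply, reverseIndex] using e'.tp3
  · simpa [diagonalCoeff, mul_add, mul_comm, mirror_apply, reverseIndex] using e'.sp3
  · simpa [diagonalCoeff, mul_add, mul_comm, mirror_apply, reverseIndex] using e'.rp3
  · simpa [diagonalCoeff, mul_add, mul_comm, mirror_apply, reverseIndex] using e'.up3
  · simpa [diagonalCoeff, mul_add, mul_comm] using e₀.rs3
  · simpa [diagonalCoeff, mul_add, mul_comm] using e₀.s4
  · simpa [diagonalCoeff, mul_add, mul_comm] using e₀.s3t
  · simpa [diagonalCoeff, mul_add, mul_comm] using e₀.us3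

theorem mem_range_tensorRelation {w : Fin 4 → F} {y : Fin 5 → F} (hy : y 4 = 0)
    (hc : ∀ i, c i = w i • y) : c ∈ (tensorRelation w).range := by
  refine ⟨![y 0, y 1, y 2, y 3], funext fun i => ?_⟩
  ext v
  fin_cases v <;> simp [tensorRelation, hc, hy]

theorem finrank_range_tensorRelation {w : Fin 4 → F} {i : Fin 4} (hw : w i ≠ 0) :
    Module.finrank F (tensorRelation w).range = 4 := by
  rw [LinearMap.finrank_range_of_inj (tensorRelation_injective hw), Module.finrank_fin_fun]

theorem rows_of_mem_relations_one (h : c ∈ relations (diagonalCoeff 1 β γ)) :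
    c 1 = -c 0 ∧ c 2 = -(β • c 0) ∧ c 3 = γ • c 0 := by
  obtain ⟨h01, h02, -, -, h13, -⟩ :=
    row_equations h (last_eq_zero h (Or.inl one_ne_zero))
  rw [one_smul] at h01 h02 h13
  have h1 : c 1 = -c 0 := eq_neg_of_add_eq_zero_right h01
  rw [h1, smul_neg, neg_add_eq_zero] at h13
  exact ⟨h1, eq_neg_of_add_eq_zero_right h02, h13.symm⟩

theorem relations_diagonalCoeff_one (hβ : β = 0 ∨ β = -1) (hγ : γ = 0 ∨ γ = -1) :
    relations (diagonalCoeff 1 β γ) = (tensorRelation ![1, -1, -β, γ]).range := by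
  refine le_antisymm (fun c hc => ?_) ?_
  · obtain ⟨h1, h2, h3⟩ := rows_of_mem_relations_one hc
    refine mem_range_tensorRelation (last_eq_zero hc (Or.inl one_ne_zero) 0) fun i => ?_
    fin_cases i <;> simp [h1, h2, h3]
  · rintro _ ⟨x, rfl⟩
    apply tensorRelation_mem_relations <;> rcases hβ with rfl | rfl <;>
      rcases hγ with rfl | rfl <;> simp

theorem relations_diagonalCoeff_one_eq_bot
    (h : ¬((β = 0 ∨ β = -1) ∧ (γ = 0 ∨ γ = -1))) : relations (diagonalCoeff 1 β γ) = ⊥ := by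
  refine (Submodule.eq_bot_iff _).2 fun c hc => ?_
  obtain ⟨h1, h2, h3⟩ := rows_of_mem_relations_one hc
  obtain ⟨-, -, h03, h12, -, -⟩ := row_equations hc (last_eq_zero hc (Or.inl one_ne_zero))
  have hβ : (β * (1 + β)) • c 0 = 0 := by
    rw [mul_smul, add_smul, one_smul, ← neg_eq_zero, ← smul_neg, neg_add, ← h2, ← h1, h12]
  have hγ : (γ * (1 + γ)) • c 0 = 0 := by rw [mul_smul, add_smul, one_smul, ← h3, h03]
  have h0 : c 0 = 0 := by
    by_contra h0
    simp only [smul_eq_zero, h0, mul_eq_zero, or_false, add_eq_zero_iff_neg_eq] at hβ hγ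
    exact h ⟨hβ.imp_right Eq.symm, hγ.imp_right Eq.symm⟩
  exact eq_zero_of_rows h0 (by simp [h1, h0]) (by simp [h2, h0]) (by simp [h3, h0])

theorem relations_diagonalCoeff_zero_one_zero :
    relations (diagonalCoeff (0 : F) 1 0) = (tensorRelation ![0, 1, -1, 0]).range := by
  refine le_antisymm (fun c hc => ?_) ?_
  · have hlast := last_eq_zero hc (Or.inr one_ne_zero)
    obtain ⟨-, h0, -, h2, -, h3⟩ := row_equations hc hlast
    simp only [one_smul, zero_smul, add_zero] at h0 h2 h3
    refine mem_range_tensorRelation (hlast 1) fun i => ?_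
    fin_cases i <;> simp [h0, h3, eq_neg_of_add_eq_zero_right h2]
  · rintro _ ⟨x, rfl⟩
    apply tensorRelation_mem_relations <;> simp

theorem relations_diagonalCoeff_zero_one_eq_bot (hγ : γ ≠ 0) :
    relations (diagonalCoeff 0 1 γ) = ⊥ := by
  refine (Submodule.eq_bot_iff _).2 fun c hc => ?_
  obtain ⟨-, h0, h3, h2, h1, -⟩ := row_equations hc (last_eq_zero hc (Or.inr one_ne_zero))
  simp only [one_smul, zero_smul, add_zero, smul_eq_zero, hγ, false_or] at h0 h1 h2 h3
  exact eq_zero_of_rows h0 h1 (by simpa [h1] using h2) (by simpa [h0] using h3)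

end Diagonal

section Rank

open OpMon

variable {F : Type*} [Field F] {a : Fin 10 → F}

theorem diagonalCoeff_comp_reverseIndex (α β γ : F) :
    diagonalCoeff α β γ ∘ reverseIndex = diagonalCoeff α γ β := by
  ext k
  fin_cases k <;> rfl

/-- The coefficients of the polynomials in `rank16Identities`. -/
def rank16Coeffs (F : Type*) [Field F] : Set (Fin 10 → F) :=
  {diagonalCoeff 1 0 0, diagonalCoeff 1 0 (-1), diagonalCoeff 1 (-1) 0,
    diagonalCoeff 1 (-1) (-1), diagonalCoeff 0 1 0, diagonalCoeff 0 0 1}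

/-- The coefficients of the polynomials in `rank19Identities`. -/
def rank19Coeffs (F : Type*) [Field F] : Set (Fin 10 → F) :=
  fourTermCoeff '' {t | t ^ 4 = 1} ∪ (fun t => fourTermCoeff t ∘ reverseIndex) '' {t | t ^ 4 = 1}

theorem diagonalCoeff_inj {α β γ α' β' γ' : F} :
    diagonalCoeff α β γ = diagonalCoeff α' β' γ' ↔ α = α' ∧ β = β' ∧ γ = γ' :=
  ⟨fun h => ⟨congrFun h 0, congrFun h 3, congrFun h 9⟩,
    fun ⟨hα, hβ, hγ⟩ => by rw [hα, hβ, hγ]⟩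

theorem diagonalCoeff_one_mem_rank16Coeffs_iff {β γ : F} :
    diagonalCoeff 1 β γ ∈ rank16Coeffs F ↔ (β = 0 ∨ β = -1) ∧ (γ = 0 ∨ γ = -1) := by
  simp only [rank16Coeffs, Set.mem_insert_iff, Set.mem_singleton_iff, diagonalCoeff_inj,
    one_ne_zero, true_and, false_and, or_false]
  tauto

theorem finrank_relations_of_mem_rank16Coeffs (ha : a ∈ rank16Coeffs F) :
    Module.finrank F (relations a) = 4 := by
  have hone {β γ : F} (h : diagonalCoeff 1 β γ ∈ rank16Coeffs F) :
      Module.finrank F (relations (diagonalCoeff 1 β γ)) = 4 := by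
    obtain ⟨hβ, hγ⟩ := diagonalCoeff_one_mem_rank16Coeffs_iff.1 h
    rw [relations_diagonalCoeff_one hβ hγ]
    exact finrank_range_tensorRelation (i := 0) one_ne_zero
  have hzero : Module.finrank F (relations (diagonalCoeff (0 : F) 1 0)) = 4 := by
    rw [relations_diagonalCoeff_zero_one_zero]
    exact finrank_range_tensorRelation (i := 1) one_ne_zero
  obtain rfl | rfl | rfl | rfl | rfl | rfl := id ha
  · exact hone ha
  · exact hone ha
  · exact hone ha
  · exact hone ha
  · exact hzero
  · rwa [← diagonalCoeff_comp_reverseIndex, finrank_relations_comp_reverseIndex]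

theorem finrank_relations_of_mem_rank19Coeffs (ha : a ∈ rank19Coeffs F) :
    Module.finrank F (relations a) = 1 := by
  obtain ⟨t, ht, rfl⟩ | ⟨t, ht, rfl⟩ := ha
  · exact finrank_relations_fourTermCoeff ht
  · exact (finrank_relations_comp_reverseIndex _).trans (finrank_relations_fourTermCoeff ht)

theorem IsNormalized.zero_eq_zero_or_one (ha : IsNormalized a) : a 0 = 0 ∨ a 0 = 1 := by
  obtain ⟨k, hk, h⟩ := ha
  rcases eq_or_ne k 0 with rfl | hk0
  · exact Or.inr hk
  · exact Or.inl (h 0 (Fin.pos_of_ne_zero hk0))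

theorem IsNormalized.diagonalCoeff_cases {α β γ : F} (ha : IsNormalized (diagonalCoeff α β γ)) :
    α = 1 ∨ α = 0 ∧ β = 1 ∨ α = 0 ∧ β = 0 ∧ γ = 1 := by
  obtain ⟨k, hk, h⟩ := ha
  fin_cases k
  all_goals first
    | exact absurd hk zero_ne_one
    | exact Or.inl hk
    | exact Or.inr (Or.inl ⟨h 0 (by decide), hk⟩)
    | exact Or.inr (Or.inr ⟨h 0 (by decide), h 3 (by decide), hk⟩)

theorem relations_diagonalCoeff_eq_bot {α β γ : F} (ha : IsNormalized (diagonalCoeff α β γ))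
    (h16 : diagonalCoeff α β γ ∉ rank16Coeffs F) : relations (diagonalCoeff α β γ) = ⊥ := by
  obtain rfl | ⟨rfl, rfl⟩ | ⟨rfl, rfl, rfl⟩ := ha.diagonalCoeff_cases
  · exact relations_diagonalCoeff_one_eq_bot (mt diagonalCoeff_one_mem_rank16Coeffs_iff.2 h16)
  · refine relations_diagonalCoeff_zero_one_eq_bot ?_
    rintro rfl
    simp [rank16Coeffs] at h16
  · simp [rank16Coeffs] at h16

theorem relations_eq_bot_of_notMem (hF : (2 : F) ≠ 0) (ha : IsNormalized a)
    (h16 : a ∉ rank16Coeffs F) (h19 : a ∉ rank19Coeffs F) : relations a = ⊥ := by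
  have h0 := ha.zero_eq_zero_or_one
  by_cases h1 : a 1 = 0
  · by_cases h4 : a 4 = 0
    · by_cases hdiag : a = diagonalCoeff (a 0) (a 3) (a 9)
      · rw [hdiag] at ha h16 ⊢
        exact relations_diagonalCoeff_eq_bot ha h16
      · exact relations_eq_bot_of_ne_diagonalCoeff h1 h4 hdiag
    · refine relations_comp_reverseIndex_eq_bot_iff.1
        (relations_eq_bot_of_one_ne_zero hF h0 h4 fun ht h => h19 (Or.inr ⟨a 4, ht, ?_⟩))
      calc fourTermCoeff (a 4) ∘ reverseIndex = (a ∘ reverseIndex) ∘ reverseIndex := by rw [h]; rfl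
        _ = a := by rw [Function.comp_assoc, reverseIndex_involutive.comp_self, Function.comp_id]
  · exact relations_eq_bot_of_one_ne_zero hF h0 h1 fun ht h => h19 (Or.inl ⟨a 1, ht, h.symm⟩)

theorem rank_of_mem_rank16Coeffs (ha : a ∈ rank16Coeffs F) : (consequenceMatrix a).rank = 16 := by
  have h := rank_consequenceMatrix_add_finrank_relations a
  rw [finrank_relations_of_mem_rank16Coeffs ha] at h
  lia

theorem rank_of_mem_rank19Coeffs (ha : a ∈ rank19Coeffs F) : (consequenceMatrix a).rank = 19 := by
  have h := rank_consequenceMatrix_add_finrank_relations a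
  rw [finrank_relations_of_mem_rank19Coeffs ha] at h
  lia

theorem rank_of_notMem (hF : (2 : F) ≠ 0) (ha : IsNormalized a) (h16 : a ∉ rank16Coeffs F)
    (h19 : a ∉ rank19Coeffs F) : (consequenceMatrix a).rank = 20 := by
  have h := rank_consequenceMatrix_add_finrank_relations a
  rwa [relations_eq_bot_of_notMem hF ha h16 h19, finrank_bot, add_zero] at h

theorem rank_eq_sixteen_iff (hF : (2 : F) ≠ 0) (ha : IsNormalized a) :
    (consequenceMatrix a).rank = 16 ↔ a ∈ rank16Coeffs F := by
  refine ⟨fun h => ?_, rank_of_mem_rank16Coeffs⟩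
  by_contra h16
  by_cases h19 : a ∈ rank19Coeffs F
  · simp [rank_of_mem_rank19Coeffs h19] at h
  · simp [rank_of_notMem hF ha h16 h19] at h

theorem rank_eq_nineteen_iff (hF : (2 : F) ≠ 0) (ha : IsNormalized a) :
    (consequenceMatrix a).rank = 19 ↔ a ∈ rank19Coeffs F := by
  refine ⟨fun h => ?_, rank_of_mem_rank19Coeffs⟩
  by_contra h19
  by_cases h16 : a ∈ rank16Coeffs F
  · simp [rank_of_mem_rank16Coeffs h16] at h
  · simp [rank_of_notMem hF ha h16 h19] at h

end Rank

section Identities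

open OpMon

theorem monomials23_injective : Function.Injective monomials23 := by
  unfold Function.Injective
  decide +kernel

theorem identity23_apply {S : Type*} [CommRing S] (a : Fin 10 → S) (k : Fin 10) :
    identity23 a (monomials23 k) = a k := by
  rw [identity23, Finsupp.finsetSum_apply, Finset.sum_eq_single k, Finsupp.single_eq_same]
  · exact fun l _ hl => Finsupp.single_eq_of_ne fun h => hl (monomials23_injective h.symm)
  · exact fun hk => absurd (Finset.mem_univ k) hk

theorem identity23_injective {S : Type*} [CommRing S] :
    Function.Injective (identity23 : (Fin 10 → S) → OpPoly S) := fun a b h =>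
  funext fun k => by rw [← identity23_apply a, h, identity23_apply]

variable {F : Type*} [Field F] {a : Fin 10 → F}

theorem identity23_diagonalCoeff (α β γ : F) : identity23 (diagonalCoeff α β γ) =
    α • mono F (op (op (op (arg * arg)))) + β • mono F (op (op (op arg)) * arg) +
      γ • mono F (arg * op (op (op arg))) := by
  simp [identity23, Fin.sum_univ_succ, monomials23, diagonalCoeff, mono, add_assoc]

theorem identity23_fourTermCoeff (t : F) :
    identity23 (fourTermCoeff t) = fourTermLeft t (t ^ 2) (t ^ 3) := by
  simp [identity23, Fin.sum_univ_succ, monomials23, fourTermCoeff, fourTermLeft, mono, add_assoc]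

theorem identity23_fourTermCoeff_comp_reverseIndex (t : F) :
    identity23 (fourTermCoeff t ∘ reverseIndex) = fourTermRight t (t ^ 2) (t ^ 3) := by
  simp [identity23, Fin.sum_univ_succ, monomials23, fourTermCoeff, reverseIndex, fourTermRight,
    mono, add_assoc]

theorem rank16Identities_eq : rank16Identities F = identity23 '' rank16Coeffs F := by
  simp only [rank16Coeffs, Set.image_insert_eq, Set.image_singleton, identity23_diagonalCoeff,
    rank16Identities, zero_smul, add_zero, zero_add, neg_smul, one_smul, ← sub_eq_add_neg, sub_sub]

theorem pow_four_eq_one_iff {t : F} : t ^ 4 = 1 ↔ t = 1 ∨ t = -1 ∨ t ^ 2 = -1 := by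
  rw [show t ^ 4 = (t ^ 2) ^ 2 by rw [← pow_mul], sq_eq_one_iff, sq_eq_one_iff, or_assoc]

theorem image_pow_four_eq_one {α : Type*} (f : F → F → F → α) :
    (fun t => f t (t ^ 2) (t ^ 3)) '' {t | t ^ 4 = 1} = {f 1 1 1, f (-1) 1 (-1)} ∪
      {x | ∃ i : F, i ^ 2 = -1 ∧ (x = f i (-1) (-i) ∨ x = f (-i) (-1) i)} := by
  have hone : f (-1) ((-1) ^ 2) ((-1) ^ 3) = f (-1) 1 (-1) := by norm_num
  have hroot {i : F} (hi : i ^ 2 = -1) : f i (i ^ 2) (i ^ 3) = f i (-1) (-i) := by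
    rw [pow_succ i 2, hi, neg_one_mul]
  have hneg {i : F} (hi : i ^ 2 = -1) : (-i) ^ 2 = -1 := by rw [neg_sq, hi]
  ext x
  constructor
  · rintro ⟨t, ht, rfl⟩
    rcases pow_four_eq_one_iff.1 ht with rfl | rfl | hi
    · simp
    · exact Or.inl (Or.inr hone)
    · exact Or.inr ⟨t, hi, Or.inl (hroot hi)⟩
  · rintro ((rfl | rfl) | ⟨i, hi, rfl | rfl⟩)
    · exact ⟨1, by simp⟩
    · exact ⟨-1, pow_four_eq_one_iff.2 (Or.inr (Or.inl rfl)), hone⟩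
    · exact ⟨i, pow_four_eq_one_iff.2 (Or.inr (Or.inr hi)), hroot hi⟩
    · exact ⟨-i, pow_four_eq_one_iff.2 (Or.inr (Or.inr (hneg hi))),
        (hroot (hneg hi)).trans (by rw [neg_neg])⟩

theorem rank19Identities_eq : rank19Identities F = identity23 '' rank19Coeffs F := by
  ext P
  simp only [rank19Identities, rank19Coeffs, Set.image_union, Set.image_image,
    identity23_fourTermCoeff, identity23_fourTermCoeff_comp_reverseIndex,
    image_pow_four_eq_one fourTermLeft, image_pow_four_eq_one fourTermRight, Set.mem_union,
    Set.mem_insert_iff, Set.mem_singleton_iff, Set.mem_ofPred_eq, and_or_left, exists_or]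
  exact iff_of_eq (by ac_rfl)

theorem identity23_mem_rank16Identities_iff :
    identity23 a ∈ rank16Identities F ↔ a ∈ rank16Coeffs F := by
  rw [rank16Identities_eq, identity23_injective.mem_set_image]

theorem identity23_mem_rank19Identities_iff :
    identity23 a ∈ rank19Identities F ↔ a ∈ rank19Coeffs F := by
  rw [rank19Identities_eq, identity23_injective.mem_set_image]

end Identities

section Counting

open OpMon

variable {F : Type*} [Field F] {a : Fin 10 → F}

theorem isNormalized_of_zero_eq_one (h : a 0 = 1) : IsNormalized a :=
  ⟨0, h, fun j hj => absurd hj (Fin.not_lt_zero j)⟩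

theorem isNormalized_of_mem_rank16Coeffs (ha : a ∈ rank16Coeffs F) : IsNormalized a := by
  rcases ha with rfl | rfl | rfl | rfl | rfl | rfl
  · exact isNormalized_of_zero_eq_one rfl
  · exact isNormalized_of_zero_eq_one rfl
  · exact isNormalized_of_zero_eq_one rfl
  · exact isNormalized_of_zero_eq_one rfl
  · exact ⟨3, rfl, by simp [Fin.forall_fin_succ, diagonalCoeff]⟩
  · exact ⟨9, rfl, by simp [Fin.forall_fin_succ, diagonalCoeff]⟩

theorem isNormalized_of_mem_rank19Coeffs (ha : a ∈ rank19Coeffs F) : IsNormalized a := by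
  rcases ha with ⟨t, -, rfl⟩ | ⟨t, -, rfl⟩
  · exact isNormalized_of_zero_eq_one rfl
  · exact isNormalized_of_zero_eq_one rfl

theorem ncard_rank16Coeffs (F : Type*) [Field F] : (rank16Coeffs F).ncard = 6 := by
  rw [rank16Coeffs, Set.ncard_insert_of_notMem, Set.ncard_insert_of_notMem,
    Set.ncard_insert_of_notMem, Set.ncard_insert_of_notMem, Set.ncard_pair]
  all_goals simp [diagonalCoeff_inj]

theorem ncard_pow_four_eq_one (hF : (2 : F) ≠ 0) {i : F} (hi : i ^ 2 = -1) :
    {t : F | t ^ 4 = 1}.ncard = 4 := by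
  have horder : orderOf i = 2 ^ (1 + 1) := by
    refine orderOf_eq_prime_pow ?_ ?_
    · rw [pow_one, hi]
      exact fun h => hF (by linear_combination -h)
    · linear_combination (i ^ 2 - 1) * hi
  have hprim : IsPrimitiveRoot i 4 := IsPrimitiveRoot.iff_orderOf.2 horder
  have hroots : {t : F | t ^ 4 = 1} = Polynomial.nthRootsFinset 4 (1 : F) := by
    ext t
    exact (Polynomial.mem_nthRootsFinset four_pos 1).symm
  rw [hroots, Set.ncard_coe_finset, hprim.card_nthRootsFinset]

theorem ncard_rank19Coeffs (hF : (2 : F) ≠ 0) (hsq : IsSquare (-1 : F)) :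
    (rank19Coeffs F).ncard = 8 := by
  obtain ⟨i, hi⟩ := hsq
  have hcard := ncard_pow_four_eq_one hF (i := i) (by rw [sq, hi])
  have hfin : {t : F | t ^ 4 = 1}.Finite := Set.finite_of_ncard_ne_zero (by simp [hcard])
  have hdisj : Disjoint (fourTermCoeff '' {t : F | t ^ 4 = 1})
      ((fun t => fourTermCoeff t ∘ reverseIndex) '' {t | t ^ 4 = 1}) := by
    refine Set.disjoint_left.2 ?_
    rintro _ ⟨s, hs, rfl⟩ ⟨t, -, h⟩
    obtain rfl : 0 = s := congrFun h 1
    simp at hs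
  rw [rank19Coeffs, Set.ncard_union_eq hdisj (hfin.image _) (hfin.image _),
    Set.ncard_image_of_injective _ fun s t h => congrFun h 1,
    Set.ncard_image_of_injective _ fun s t h => congrFun h 4, hcard]

end Counting

section Enumeration

namespace OpMon

open Finset

/-- An enumeration of the operator monomials of degree `p` and multiplicity `q`, complete as soon
as `p + q ≤ n`. -/
def ofDegreeMultiplicity : ℕ → ℕ → ℕ → Finset OpMon
  | 0, _, _ => ∅
  | _ + 1, 0, _ => ∅
  | n + 1, p + 1, 0 => if p = 0 then {arg} else (ofDegreeMultiplicity n p 0).image argMul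
  | n + 1, p + 1, q + 1 =>
    (ofDegreeMultiplicity n (p + 1) q).image op ∪
      (ofDegreeMultiplicity n p (q + 1)).image argMul ∪
      (HasAntidiagonal.antidiagonal (p + 1) ×ˢ HasAntidiagonal.antidiagonal q).biUnion fun x =>
        image₂ opMul (ofDegreeMultiplicity n x.1.1 x.2.1) (ofDegreeMultiplicity n x.1.2 x.2.2)

theorem degree_eq_and_multiplicity_eq_of_mem {n p q : ℕ} {m : OpMon}
    (h : m ∈ ofDegreeMultiplicity n p q) : m.degree = p ∧ m.multiplicity = q := by
  induction n generalizing p q m with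
  | zero => exact absurd h (notMem_empty m)
  | succ n ih =>
    match p, q with
    | 0, q => exact absurd h (notMem_empty m)
    | p + 1, 0 =>
      rw [ofDegreeMultiplicity] at h
      split_ifs at h with hp
      · obtain rfl := mem_singleton.1 h
        exact ⟨by rw [hp, degree], rfl⟩
      · obtain ⟨m, hm, rfl⟩ := mem_image.1 h
        exact ⟨congrArg (· + 1) (ih hm).1, (ih hm).2⟩
    | p + 1, q + 1 =>
      simp only [ofDegreeMultiplicity, mem_union, mem_image, mem_biUnion, mem_product,
        HasAntidiagonal.mem_antidiagonal, mem_image₂] at h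
      obtain (⟨m, hm, rfl⟩ | ⟨m, hm, rfl⟩) | ⟨x, ⟨hp, hq⟩, m, hm, m', hm', rfl⟩ := h
      · exact ⟨(ih hm).1, congrArg (· + 1) (ih hm).2⟩
      · exact ⟨congrArg (· + 1) (ih hm).1, (ih hm).2⟩
      · simp only [degree, multiplicity, (ih hm).1, (ih hm).2, (ih hm').1, (ih hm').2]
        lia

theorem mem_ofDegreeMultiplicity {n p q : ℕ} {m : OpMon} (hp : m.degree = p)
    (hq : m.multiplicity = q) (hn : p + q ≤ n) : m ∈ ofDegreeMultiplicity n p q := by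
  induction n generalizing p q m with
  | zero => exact absurd (one_le_degree m) (by lia)
  | succ n ih =>
    match p, q, m with
    | 0, q, m => exact absurd (one_le_degree m) (by lia)
    | p + 1, 0, arg => simp_all [ofDegreeMultiplicity, degree]
    | p + 1, 0, argMul m =>
      have hm : m.degree = p := Nat.succ.inj hp
      have := one_le_degree m
      rw [ofDegreeMultiplicity, if_neg (by lia)]
      exact mem_image_of_mem _ (ih hm hq (by lia))
    | p + 1, 0, opMul m m' => exact absurd hq (by simp only [multiplicity]; lia)
    | p + 1, q + 1, op m =>
      exact mem_union_left _ (mem_union_left _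
        (mem_image_of_mem _ (ih hp (Nat.succ.inj hq) (by lia))))
    | p + 1, q + 1, argMul m =>
      exact mem_union_left _ (mem_union_right _
        (mem_image_of_mem _ (ih (Nat.succ.inj hp) hq (by lia))))
    | p + 1, q + 1, opMul m m' =>
      have hm := one_le_degree m
      have hm' := one_le_degree m'
      simp only [degree, multiplicity] at hp hq
      refine mem_union_right _ (mem_biUnion.2
        ⟨((m.degree, m'.degree), (m.multiplicity, m'.multiplicity)), mem_product.2 ⟨?_, ?_⟩,
          mem_image₂_of_mem (ih rfl rfl ?_) (ih rfl rfl ?_)⟩)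
      · exact HasAntidiagonal.mem_antidiagonal.2 hp
      · exact HasAntidiagonal.mem_antidiagonal.2 (by lia)
      all_goals lia

end OpMon

theorem operatorMonomials_eq (p q : ℕ) :
    operatorMonomials p q = OpMon.ofDegreeMultiplicity (p + q) p q :=
  Set.ext fun _ => ⟨fun h => OpMon.mem_ofDegreeMultiplicity h.1 h.2 le_rfl,
    OpMon.degree_eq_and_multiplicity_eq_of_mem⟩

theorem card_operatorMonomials_three_four : Nat.card (operatorMonomials 3 4) = 105 := by
  rw [operatorMonomials_eq, Nat.card_coe_set_eq, Set.ncard_coe_finset]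
  decide +kernel

end Enumeration

theorem theorem1_general (F : Type*) [Field F] (hF : (2 : F) ≠ 0) :
    (Nat.card (operatorMonomials 3 4) = 105 ∧
      Nat.card (consequences 2 (genericIdentity23 F)) = 20) ∧
    (∀ a : Fin 10 → F, IsNormalized a →
      ((consequenceMatrix a).rank = 16 ↔ identity23 a ∈ rank16Identities F) ∧
      ((consequenceMatrix a).rank = 19 ↔ identity23 a ∈ rank19Identities F) ∧
      (identity23 a ∉ rank16Identities F → identity23 a ∉ rank19Identities F →
        (consequenceMatrix a).rank = 20)) ∧
    {a : Fin 10 → F | IsNormalized a ∧ (consequenceMatrix a).rank = 16}.ncard = 6 ∧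
    (IsSquare (-1 : F) →
      {a : Fin 10 → F | IsNormalized a ∧ (consequenceMatrix a).rank = 19}.ncard = 8) := by
  refine ⟨⟨card_operatorMonomials_three_four, card_consequences_genericIdentity23 F⟩,
    fun a ha => ?_, ?_, fun hsq => ?_⟩
  · rw [identity23_mem_rank16Identities_iff, identity23_mem_rank19Identities_iff]
    exact ⟨rank_eq_sixteen_iff hF ha, rank_eq_nineteen_iff hF ha, rank_of_notMem hF ha⟩
  · rw [← ncard_rank16Coeffs F]
    congr 1
    ext a
    exact ⟨fun h => (rank_eq_sixteen_iff hF h.1).1 h.2,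
      fun h => ⟨isNormalized_of_mem_rank16Coeffs h, rank_of_mem_rank16Coeffs h⟩⟩
  · rw [← ncard_rank19Coeffs hF hsq]
    congr 1
    ext a
    exact ⟨fun h => (rank_eq_nineteen_iff hF h.1).1 h.2,
      fun h => ⟨isNormalized_of_mem_rank19Coeffs h, rank_of_mem_rank19Coeffs h⟩⟩

theorem theorem1 (F : Type*) [Field F] [CharZero F] :
    -- the size of the matrix of consequences
    (Nat.card (operatorMonomials 3 4) = 105 ∧
      Nat.card (consequences 2 (genericIdentity23 F)) = 20) ∧
    -- the rank of the matrix for every normalized coefficient vector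
    (∀ a : Fin 10 → F, IsNormalized a →
      ((consequenceMatrix a).rank = 16 ↔ identity23 a ∈ rank16Identities F) ∧
      ((consequenceMatrix a).rank = 19 ↔ identity23 a ∈ rank19Identities F) ∧
      (identity23 a ∉ rank16Identities F → identity23 a ∉ rank19Identities F →
        (consequenceMatrix a).rank = 20)) ∧
    -- the numbers of identities
    {a : Fin 10 → F | IsNormalized a ∧ (consequenceMatrix a).rank = 16}.ncard = 6 ∧
    (IsSquare (-1 : F) →
      {a : Fin 10 → F | IsNormalized a ∧ (consequenceMatrix a).rank = 19}.ncard = 8) :=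
  theorem1_general F two_ne_zero
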